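/- Conventions. Manifolds are smooth, Hausdorff and second countable, all of the same dimension $m \ge 1$, with possibly empty boundary. A Riemannian manifold $(X,g)$ is complete if it is complete as a metric space for the intrinsic distance of $g$ (the infimum of the lengths of piecewise $C^1$ paths joining two points, infinite if there are none). A Riemannian extension of $(X,g_X)$ is a Riemannian manifold $(Y,g_Y)$ with possibly empty boundary together with a smooth embedding $f\colon X\to Y$ with $f(X)\subseteq \operatorname{int} Y$ and $f^*g_Y=g_X$. Lemma. Let $(M,g_M)$ be an $m$-dimensional Riemannian manifold with non-empty boundary. Let $(P,g_P)$, with embedding $i\colon M\to P$, be a complete Riemannian extension of $(M,g_M)$ with non-empty boundary, and let $(N,\tilde g)$, with embedding $j\colon P\to N$, be a Riemannian extension of $(P,g_P)$ such that $j(P)$ is closed in $N$. Then there is a smooth Riemannian metric $g_N$ on $N$ such that $(N,g_N)$, with the embedding $j\circ i$, is still a Riemannian extension of $(M,g_M)$, and $(N,g_N)$ is complete. Moreover, $g_N$ can be chosen as a conformal deformation of $\tilde g$ supported away from $M$: $g_N=e^{2\varphi}\tilde g$ with $\varphi\in C^\infty(N)$ and $\operatorname{supp}\varphi\subseteq N\setminus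 j(i(M))$. -/

import Mathlib

open Set Topology
open scoped Manifold ContDiff Bundle

noncomputable section

namespace RiemExt

/-- A smooth Riemannian metric on a smooth `m`-dimensional manifold with (possibly empty) boundary,
modelled on the Euclidean half-space. -/
abbrev SmoothMetric (m : ℕ) [NeZero m] (M : Type*) [TopologicalSpace M]
    [ChartedSpace (EuclideanHalfSpace m) M] [IsManifold (𝓡∂ m) ∞ M] :=
  Bundle.ContMDiffRiemannianMetric (𝓡∂ m) ∞ (EuclideanSpace ℝ (Fin m))
    (fun x : M ↦ TangentSpace (𝓡∂ m) x)

/-- The Riemannian manifold `(M, g)` is complete: `M` is a complete metric space for the intrinsic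
distance of `g`, the infimum of the `g`-lengths of `C¹` paths joining two given points (this
distance is infinite between different connected components). -/
def IsCompleteMetric {m : ℕ} [NeZero m] {M : Type*} [TopologicalSpace M] [T2Space M]
    [ChartedSpace (EuclideanHalfSpace m) M] [IsManifold (𝓡∂ m) ∞ M]
    (g : SmoothMetric m M) : Prop :=
  letI : Bundle.RiemannianBundle (fun x : M ↦ TangentSpace (𝓡∂ m) x) := ⟨g.toRiemannianMetric⟩
  haveI : IsContinuousRiemannianBundle (EuclideanSpace ℝ (Fin m))
      (fun x : M ↦ TangentSpace (𝓡∂ m) x) := ⟨g.inner, g.contMDiff.continuous, fun _ _ _ ↦ rfl⟩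
  haveI : LocallyCompactSpace M := Manifold.locallyCompact_of_finiteDimensional (𝓡∂ m)
  letI : EMetricSpace M := EMetricSpace.ofRiemannianMetric (𝓡∂ m) M
  CompleteSpace M

/-- `f : M → N` exhibits `(N, gN)` as a Riemannian extension of the manifold `(M, gM)` of the same
dimension: `f` is an isometric (in the sense of Riemannian metrics) smooth embedding of `M` into
the interior of `N`. The differential of `f` is injective because `f` is isometric, so that `f` is
an immersion. -/
structure IsRiemannianExtension {m : ℕ} [NeZero m]
    {M : Type*} [TopologicalSpace M] [ChartedSpace (EuclideanHalfSpace m) M]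
    [IsManifold (𝓡∂ m) ∞ M]
    {N : Type*} [TopologicalSpace N] [ChartedSpace (EuclideanHalfSpace m) N]
    [IsManifold (𝓡∂ m) ∞ N]
    (gM : SmoothMetric m M) (gN : SmoothMetric m N) (f : M → N) : Prop where
  contMDiff : ContMDiff (𝓡∂ m) (𝓡∂ m) ∞ f
  isEmbedding : IsEmbedding f
  range_subset_interior : range f ⊆ (𝓡∂ m).interior N
  isometric : ∀ (x : M) (v w : TangentSpace (𝓡∂ m) x),
    gN.inner (f x) (mfderiv (𝓡∂ m) (𝓡∂ m) f x v) (mfderiv (𝓡∂ m) (𝓡∂ m) f x w) = gM.inner x v w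

end RiemExt

end

noncomputable section

namespace RiemExt

open Filter MeasureTheory
open scoped ENNReal NNReal

/-! ### Norm, length and intrinsic distance of a metric -/

variable {m : ℕ} [NeZero m] {X : Type*} [TopologicalSpace X]
  [ChartedSpace (EuclideanHalfSpace m) X] [IsManifold (𝓡∂ m) ∞ X]

/-! Paths of $N$ may leave $j(P)$ and come back, so the distance of $N$ between points of $j(P)$ can
be smaller than that of $P$, and completeness of $P$ does not transfer directly. Locally the two
distances agree up to a factor 2, even at boundary points, because the half-space is convex
(`eventually_edist_le_two_mul`). This yields a positive radius `lam` on $P$, 1-Lipschitz for the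
distance of $N$ (`exists_isRadius`). The balls of radius `lam a / 8` about the points `j a` form an
open neighbourhood $V$ of $j(P)$, and a path in $V$ is shadowed by a chain of points of $P$ whose
total distance is controlled by the length of the path (`IsRadius.edist_le_of_path`).

Let $f\colon N\to[0,1]$ vanish on the closed set $j(P)$ and equal 1 exactly off $V$, let $\rho$ be a
smooth exhaustion, let $\psi$ bound $|df|$ and $|d\rho|$, and put $\varphi=2f\psi$. Since
$e^\varphi\ge\varphi$, in the new metric $f^2$ is 1-Lipschitz and $|d\rho|\le 1/c$ wherever $2f\ge
c$. Along a Cauchy sequence $f^2$ converges. If the limit is positive, $\rho$ stays bounded on a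
tail, which therefore lies in a compact set. If it is zero, a tail and short paths between its
points stay in $V$: either the radii tend to 0 and the shadows are Cauchy in $P$, or a tail lies in
a compact set (`IsRadius.exists_tendsto`).

Finally $\varphi=0$ on $j(P)$, which is a neighbourhood of $j(i(M))$ by the inverse function
theorem, since $i(M)$ is interior in $P$. -/

/-- The norm of a tangent vector for a smooth Riemannian metric. -/
def SmoothMetric.nrm (g : SmoothMetric m X) (x : X) (v : TangentSpace (𝓡∂ m) x) : ℝ :=
  √(g.inner x v v)

/-- The length of a path on `[a, b]` for a smooth Riemannian metric. -/
def SmoothMetric.len (g : SmoothMetric m X) (γ : ℝ → X) (a b : ℝ) : ℝ≥0∞ :=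
  let : Bundle.RiemannianBundle (fun x : X ↦ TangentSpace (𝓡∂ m) x) := ⟨g.toRiemannianMetric⟩
  Manifold.pathELength (𝓡∂ m) γ a b

/-- The intrinsic distance of a smooth Riemannian metric. -/
def SmoothMetric.edist (g : SmoothMetric m X) (x y : X) : ℝ≥0∞ :=
  let : Bundle.RiemannianBundle (fun x : X ↦ TangentSpace (𝓡∂ m) x) := ⟨g.toRiemannianMetric⟩
  Manifold.riemannianEDist (𝓡∂ m) x y

variable (g : SmoothMetric m X)

theorem SmoothMetric.inner_self_nonneg (x : X) (v : TangentSpace (𝓡∂ m) x) :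
    0 ≤ g.inner x v v := by
  rcases eq_or_ne v 0 with rfl | h
  · simp
  · exact (g.pos x v h).le

theorem SmoothMetric.nrm_nonneg (x : X) (v : TangentSpace (𝓡∂ m) x) : 0 ≤ g.nrm x v :=
  Real.sqrt_nonneg _

theorem SmoothMetric.nrm_sq (x : X) (v : TangentSpace (𝓡∂ m) x) :
    g.nrm x v ^ 2 = g.inner x v v :=
  Real.sq_sqrt (g.inner_self_nonneg x v)

theorem SmoothMetric.nrm_eq_norm (x : X) (v : TangentSpace (𝓡∂ m) x) :
    letI : Bundle.RiemannianBundle (fun x : X ↦ TangentSpace (𝓡∂ m) x) := ⟨g.toRiemannianMetric⟩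
    g.nrm x v = ‖v‖ := by
  let : Bundle.RiemannianBundle (fun x : X ↦ TangentSpace (𝓡∂ m) x) := ⟨g.toRiemannianMetric⟩
  rw [norm_eq_sqrt_real_inner]
  rfl

theorem SmoothMetric.nrm_add_le (x : X) (v w : TangentSpace (𝓡∂ m) x) :
    g.nrm x (v + w) ≤ g.nrm x v + g.nrm x w := by
  let : Bundle.RiemannianBundle (fun x : X ↦ TangentSpace (𝓡∂ m) x) := ⟨g.toRiemannianMetric⟩
  simp only [g.nrm_eq_norm]
  exact norm_add_le v w

theorem SmoothMetric.nrm_smul (x : X) (c : ℝ) (v : TangentSpace (𝓡∂ m) x) :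
    g.nrm x (c • v) = |c| * g.nrm x v := by
  let : Bundle.RiemannianBundle (fun x : X ↦ TangentSpace (𝓡∂ m) x) := ⟨g.toRiemannianMetric⟩
  simp only [g.nrm_eq_norm]
  exact norm_smul c v

theorem SmoothMetric.abs_inner_le (x : X) (v w : TangentSpace (𝓡∂ m) x) :
    |g.inner x v w| ≤ g.nrm x v * g.nrm x w := by
  let : Bundle.RiemannianBundle (fun x : X ↦ TangentSpace (𝓡∂ m) x) := ⟨g.toRiemannianMetric⟩
  simp only [g.nrm_eq_norm]
  exact abs_real_inner_le_norm v w

theorem SmoothMetric.len_eq (γ : ℝ → X) (a b : ℝ) :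
    g.len γ a b =
      ∫⁻ t in Icc a b, ENNReal.ofReal (g.nrm (γ t) (mfderiv 𝓘(ℝ, ℝ) (𝓡∂ m) γ t (1 : ℝ))) := by
  let : Bundle.RiemannianBundle (fun x : X ↦ TangentSpace (𝓡∂ m) x) := ⟨g.toRiemannianMetric⟩
  unfold SmoothMetric.len
  rw [Manifold.pathELength_eq_lintegral_mfderiv_Icc]
  refine lintegral_congr fun t ↦ ?_
  rw [g.nrm_eq_norm, ofReal_norm]
  rfl

theorem SmoothMetric.len_add (γ : ℝ → X) {a b c : ℝ} (h : a ≤ b) (h' : b ≤ c) :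
    g.len γ a b + g.len γ b c = g.len γ a c := by
  let : Bundle.RiemannianBundle (fun x : X ↦ TangentSpace (𝓡∂ m) x) := ⟨g.toRiemannianMetric⟩
  exact Manifold.pathELength_add h h'

theorem SmoothMetric.len_mono (γ : ℝ → X) {a b a' b' : ℝ} (h : a' ≤ a) (h' : b ≤ b') :
    g.len γ a b ≤ g.len γ a' b' := by
  let : Bundle.RiemannianBundle (fun x : X ↦ TangentSpace (𝓡∂ m) x) := ⟨g.toRiemannianMetric⟩
  exact Manifold.pathELength_mono h h'

theorem SmoothMetric.edist_le_len {γ : ℝ → X} {a b : ℝ}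
    (hγ : ContMDiffOn 𝓘(ℝ, ℝ) (𝓡∂ m) 1 γ (Icc a b)) (hab : a ≤ b) :
    g.edist (γ a) (γ b) ≤ g.len γ a b := by
  let : Bundle.RiemannianBundle (fun x : X ↦ TangentSpace (𝓡∂ m) x) := ⟨g.toRiemannianMetric⟩
  exact Manifold.riemannianEDist_le_pathELength hγ rfl rfl hab

theorem SmoothMetric.exists_len_lt {x y : X} {r : ℝ≥0∞} (h : g.edist x y < r) :
    ∃ γ : ℝ → X, γ 0 = x ∧ γ 1 = y ∧ ContMDiff 𝓘(ℝ, ℝ) (𝓡∂ m) 1 γ ∧ g.len γ 0 1 < r := by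
  let : Bundle.RiemannianBundle (fun x : X ↦ TangentSpace (𝓡∂ m) x) := ⟨g.toRiemannianMetric⟩
  obtain ⟨γ, h0, h1, hγ, hl, -⟩ :=
    Manifold.exists_lt_locally_constant_of_riemannianEDist_lt (I := 𝓡∂ m) h zero_lt_one
  exact ⟨γ, h0, h1, hγ, hl⟩

theorem SmoothMetric.edist_self (x : X) : g.edist x x = 0 := by
  let : Bundle.RiemannianBundle (fun x : X ↦ TangentSpace (𝓡∂ m) x) := ⟨g.toRiemannianMetric⟩
  exact Manifold.riemannianEDist_self

theorem SmoothMetric.edist_comm (x y : X) : g.edist x y = g.edist y x := by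
  let : Bundle.RiemannianBundle (fun x : X ↦ TangentSpace (𝓡∂ m) x) := ⟨g.toRiemannianMetric⟩
  exact Manifold.riemannianEDist_comm

theorem SmoothMetric.edist_triangle (x y z : X) : g.edist x z ≤ g.edist x y + g.edist y z := by
  let : Bundle.RiemannianBundle (fun x : X ↦ TangentSpace (𝓡∂ m) x) := ⟨g.toRiemannianMetric⟩
  exact Manifold.riemannianEDist_triangle

theorem SmoothMetric.isContinuousRiemannianBundle :
    letI : Bundle.RiemannianBundle (fun x : X ↦ TangentSpace (𝓡∂ m) x) := ⟨g.toRiemannianMetric⟩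
    IsContinuousRiemannianBundle (EuclideanSpace ℝ (Fin m))
      (fun x : X ↦ TangentSpace (𝓡∂ m) x) :=
  let : Bundle.RiemannianBundle (fun x : X ↦ TangentSpace (𝓡∂ m) x) := ⟨g.toRiemannianMetric⟩
  ⟨g.inner, g.contMDiff.continuous, fun _ _ _ ↦ rfl⟩

theorem SmoothMetric.eventually_edist_lt (x : X) {c : ℝ≥0∞} (hc : 0 < c) :
    ∀ᶠ y in 𝓝 x, g.edist x y < c := by
  let : Bundle.RiemannianBundle (fun x : X ↦ TangentSpace (𝓡∂ m) x) := ⟨g.toRiemannianMetric⟩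
  have := g.isContinuousRiemannianBundle
  exact eventually_riemannianEDist_lt (𝓡∂ m) x hc

theorem SmoothMetric.exists_edist_lt_subset [T2Space X] {x : X} {s : Set X} (hs : s ∈ 𝓝 x) :
    ∃ c : ℝ, 0 < c ∧ ∀ y, g.edist x y < ENNReal.ofReal c → y ∈ s := by
  let : Bundle.RiemannianBundle (fun x : X ↦ TangentSpace (𝓡∂ m) x) := ⟨g.toRiemannianMetric⟩
  have := g.isContinuousRiemannianBundle
  have : LocallyCompactSpace X := Manifold.locallyCompact_of_finiteDimensional (𝓡∂ m)
  obtain ⟨c, c0, hc⟩ := setOfPred_riemannianEDist_lt_subset_nhds (𝓡∂ m) hs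
  refine ⟨c, c0, fun y hy ↦ hc ?_⟩
  rw [ENNReal.ofReal_coe_nnreal] at hy
  exact hy

theorem SmoothMetric.tendsto_of_edist [T2Space X] {u : ℕ → X} {x : X}
    (h : ∀ c : ℝ, 0 < c → ∀ᶠ n in atTop, g.edist x (u n) < ENNReal.ofReal c) :
    Tendsto u atTop (𝓝 x) := by
  intro s hs
  obtain ⟨c, c0, hc⟩ := g.exists_edist_lt_subset hs
  exact (h c c0).mono fun n hn ↦ hc _ hn

theorem SmoothMetric.isOpen_edist_lt (x : X) (c : ℝ≥0∞) : IsOpen {y | g.edist y x < c} := by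
  rw [isOpen_iff_mem_nhds]
  intro y (hy : g.edist y x < c)
  filter_upwards [g.eventually_edist_lt y (tsub_pos_of_lt hy)] with z hz
  calc g.edist z x ≤ g.edist z y + g.edist y x := g.edist_triangle _ _ _
    _ = g.edist y z + g.edist y x := by rw [g.edist_comm z y]
    _ < (c - g.edist y x) + g.edist y x :=
        ENNReal.add_lt_add_right (hy.trans_le le_top).ne hz
    _ = c := tsub_add_cancel_of_le hy.le

/-- Completeness of `g`, in terms of sequences that are Cauchy for the intrinsic distance. -/
theorem isCompleteMetric_iff [T2Space X] :
    IsCompleteMetric g ↔ ∀ u : ℕ → X,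
      (∀ c : ℝ, 0 < c → ∃ n₀, ∀ k ≥ n₀, ∀ n ≥ n₀, g.edist (u k) (u n) < ENNReal.ofReal c) →
      ∃ x, Tendsto u atTop (𝓝 x) := by
  let : Bundle.RiemannianBundle (fun x : X ↦ TangentSpace (𝓡∂ m) x) := ⟨g.toRiemannianMetric⟩
  have := g.isContinuousRiemannianBundle
  have : LocallyCompactSpace X := Manifold.locallyCompact_of_finiteDimensional (𝓡∂ m)
  let E : EMetricSpace X := EMetricSpace.ofRiemannianMetric (𝓡∂ m) X
  have key (u : ℕ → X) : CauchySeq u ↔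
      ∀ c : ℝ, 0 < c → ∃ n₀, ∀ k ≥ n₀, ∀ n ≥ n₀, g.edist (u k) (u n) < ENNReal.ofReal c := by
    rw [EMetric.cauchySeq_iff]
    constructor
    · intro h c hc
      exact h _ (ENNReal.ofReal_pos.2 hc)
    · intro h ε hε
      obtain ⟨c, c0, hc⟩ : ∃ c : ℝ, 0 < c ∧ ENNReal.ofReal c ≤ ε := by
        obtain ⟨c, c0, hc⟩ := ENNReal.lt_iff_exists_nnreal_btwn.1 hε
        refine ⟨c, by simpa using c0, ?_⟩
        rw [ENNReal.ofReal_coe_nnreal]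
        exact hc.le
      obtain ⟨n₀, h⟩ := h c c0
      exact ⟨n₀, fun k hk n hn ↦ (h k hk n hn).trans_le hc⟩
  constructor
  · intro h u hu
    have : CompleteSpace X := h
    exact cauchySeq_tendsto_of_complete ((key u).2 hu)
  · intro h
    have : CompleteSpace X := EMetric.complete_of_cauchySeq_tendsto fun u hu ↦ h u ((key u).1 hu)
    exact this

/-! ### Comparison of distances in charts -/

/-- Mean value inequality on a convex set: the derivative of the difference is continuous at `x` and
vanishes there. With the half-space as `s`, this replaces strict differentiability at boundary
points. -/
theorem exists_lipschitzOnWith_sub_fderivWithin {E F : Type*} [NormedAddCommGroup E]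
    [NormedSpace ℝ E] [NormedAddCommGroup F] [NormedSpace ℝ F] {f : E → F} {s : Set E} {x : E}
    (hs : Convex ℝ s) (hx : x ∈ s) (hU : UniqueDiffWithinAt ℝ s x)
    (hf : ContDiffWithinAt ℝ 1 f s x) {K : ℝ≥0} (hK : 0 < K) :
    ∃ t ∈ 𝓝[s] x, LipschitzOnWith K (fun y ↦ f y - fderivWithin ℝ f s x y) t := by
  have hf' : ContDiffWithinAt ℝ (0 + 1) f s x := by simpa using hf
  obtain ⟨u, hu, -, -, f', hf', hc⟩ := (contDiffWithinAt_succ_iff_hasFDerivWithinAt' (by simp)).1 hf'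
  rw [insert_eq_of_mem hx] at hu
  have hxu : x ∈ u := mem_of_mem_nhdsWithin hx hu
  have hL : fderivWithin ℝ f s x = f' x := (hf' x hxu).fderivWithin hU
  refine hs.exists_nhdsWithin_lipschitzOnWith_of_hasFDerivWithinAt_of_nnnorm_lt
    (f' := fun y ↦ f' y - fderivWithin ℝ f s x) ?_ ?_ K ?_
  · filter_upwards [hu] with y hy
    exact (hf' y hy).sub (fderivWithin ℝ f s x).hasFDerivWithinAt
  · exact hc.continuousWithinAt.sub continuousWithinAt_const
  · simpa [hL] using hK

/-- The differential at `y` of the extended chart at `x`, as a map to the tangent space at `x`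
(which is the model vector space). -/
def chartDeriv (x y : X) (v : TangentSpace (𝓡∂ m) y) : TangentSpace (𝓡∂ m) x :=
  mfderiv (𝓡∂ m) 𝓘(ℝ, EuclideanSpace ℝ (Fin m)) (extChartAt (𝓡∂ m) x) y v

/-- The differential of a real function on a manifold. -/
def dirDeriv (f : X → ℝ) (y : X) (v : TangentSpace (𝓡∂ m) y) : ℝ :=
  mfderiv (𝓡∂ m) 𝓘(ℝ, ℝ) f y v

/-- A vector of the model space, seen as a tangent vector at `x`. -/
def toTangent (x : X) (v : EuclideanSpace ℝ (Fin m)) : TangentSpace (𝓡∂ m) x := v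

/-- Near `x`, the extended chart at `x` is almost an isometry for the metric and its value at `x`
in the chart. -/
theorem SmoothMetric.eventually_nrm_chartDeriv_le (g : SmoothMetric m X) (x : X) {r : ℝ}
    (hr : 1 < r) :
    ∀ᶠ y in 𝓝 x, ∀ v : TangentSpace (𝓡∂ m) y,
      g.nrm x (chartDeriv x y v) ≤ r * g.nrm y v ∧
      g.nrm y v ≤ r * g.nrm x (chartDeriv x y v) := by
  let : Bundle.RiemannianBundle (fun x : X ↦ TangentSpace (𝓡∂ m) x) := ⟨g.toRiemannianMetric⟩
  have := g.isContinuousRiemannianBundle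
  set T := trivializationAt (EuclideanSpace ℝ (Fin m)) (TangentSpace (𝓡∂ m)) x with hT
  have key (y : X) (hy : y ∈ (chartAt (EuclideanHalfSpace m) x).source)
      (v : TangentSpace (𝓡∂ m) y) :
      T.continuousLinearMapAt ℝ y v = chartDeriv x y v :=
    congr($(TangentBundle.continuousLinearMapAt_trivializationAt (I := 𝓡∂ m) hy) v)
  have hxs : x ∈ (chartAt (EuclideanHalfSpace m) x).source := mem_chart_source _ x
  have hx : x ∈ T.baseSet := hxs
  -- On the fibre over `x` the trivialization is the identity, so the two norm estimates below
  -- concern the chart differential and its inverse.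
  have id1 (v : TangentSpace (𝓡∂ m) x) : T.continuousLinearMapAt ℝ x v = v :=
    (key x hxs v).trans congr($(mfderiv_extChartAt_self (I := 𝓡∂ m) (x := x)) v)
  have id2 (v : TangentSpace (𝓡∂ m) x) : T.symmL ℝ x v = v :=
    (congrArg (T.symmL ℝ x) (id1 v)).symm.trans (T.symmL_continuousLinearMapAt (R := ℝ) hx v)
  filter_upwards [eventually_norm_symmL_trivializationAt_self_comp_lt
      (EuclideanSpace ℝ (Fin m)) (fun x : X ↦ TangentSpace (𝓡∂ m) x) x hr,
    eventually_norm_symmL_trivializationAt_comp_self_lt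
      (EuclideanSpace ℝ (Fin m)) (fun x : X ↦ TangentSpace (𝓡∂ m) x) x hr,
    chart_source_mem_nhds (EuclideanHalfSpace m) x] with y h1 h2 hy v
  have hy' : y ∈ T.baseSet := hy
  rw [g.nrm_eq_norm, g.nrm_eq_norm]
  constructor
  · refine le_trans (le_of_eq ?_) (ContinuousLinearMap.le_of_opNorm_le _ h1.le v)
    congr 1
    exact (id2 _).symm.trans (congrArg (T.symmL ℝ x) (key y hy v).symm)
  · refine le_trans (le_of_eq ?_) (ContinuousLinearMap.le_of_opNorm_le _ h2.le (chartDeriv x y v))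
    congr 1
    exact (T.symmL_continuousLinearMapAt (R := ℝ) hy' v).symm.trans
      (congrArg (T.symmL ℝ y) ((key y hy v).trans (id1 _).symm))

theorem SmoothMetric.exists_nrm_le_norm (g : SmoothMetric m X) (x : X) :
    ∃ C : ℝ, 0 < C ∧ ∀ v : EuclideanSpace ℝ (Fin m), g.nrm x (toTangent x v) ≤ C * ‖v‖ := by
  let B : EuclideanSpace ℝ (Fin m) →L[ℝ] EuclideanSpace ℝ (Fin m) →L[ℝ] ℝ := g.inner x
  refine ⟨√(‖B‖ + 1), by positivity, fun v ↦ ?_⟩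
  refine Real.sqrt_le_iff.2 ⟨by positivity, ?_⟩
  rw [mul_pow, Real.sq_sqrt (by positivity)]
  have := (le_abs_self _).trans (B.le_opNorm₂ v v)
  change B v v ≤ _
  nlinarith [sq_nonneg ‖v‖]

theorem SmoothMetric.exists_norm_le_nrm (g : SmoothMetric m X) (x : X) :
    ∃ C : ℝ, 0 < C ∧ ∀ v : EuclideanSpace ℝ (Fin m), ‖v‖ ≤ C * g.nrm x (toTangent x v) := by
  have hb : Bornology.IsVonNBounded ℝ {v : EuclideanSpace ℝ (Fin m) | g.inner x v v < 1} :=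
    g.isVonNBounded x
  rw [NormedSpace.isVonNBounded_iff] at hb
  obtain ⟨R, R0, hR⟩ := hb.exists_pos_norm_le
  refine ⟨2 * R, by positivity, fun v ↦ ?_⟩
  rcases eq_or_ne v 0 with rfl | hv
  · simpa using mul_nonneg (by positivity) (g.nrm_nonneg x _)
  have hpos : 0 < g.nrm x (toTangent x v) := Real.sqrt_pos.2 (g.pos x _ hv)
  -- Rescaling to length 1/2 lands inside the open unit ball; hence the factor 2 in the constant.
  set a := (2 * g.nrm x (toTangent x v))⁻¹ with ha
  have h1 : g.inner x (a • toTangent x v) (a • toTangent x v) < 1 := by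
    rw [← g.nrm_sq, g.nrm_smul, abs_of_pos (by positivity), ha, mul_inv, mul_assoc,
      inv_mul_cancel₀ hpos.ne']
    norm_num
  have h2 : ‖a • v‖ ≤ R := hR _ h1
  rw [norm_smul, Real.norm_of_nonneg (by positivity), ha, inv_mul_le_iff₀ (by positivity)] at h2
  linarith

/-- A function whose differential is bounded by `c` along a path varies by at most `c` times the
length of the path. -/
theorem SmoothMetric.abs_sub_le_len (g : SmoothMetric m X) {f : X → ℝ} {γ : ℝ → X} {a b c : ℝ}
    (hab : a ≤ b)
    (hγ : ContMDiff 𝓘(ℝ, ℝ) (𝓡∂ m) 1 γ)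
    (hf : ∀ t ∈ Icc a b, ContMDiffAt (𝓡∂ m) 𝓘(ℝ, ℝ) 1 f (γ t))
    (hc : ∀ t ∈ Icc a b, ∀ v : TangentSpace (𝓡∂ m) (γ t),
      |dirDeriv f (γ t) v| ≤ c * g.nrm (γ t) v) (hc0 : 0 ≤ c) :
    ENNReal.ofReal |f (γ b) - f (γ a)| ≤ ENNReal.ofReal c * g.len γ a b := by
  have h1 : ContDiffOn ℝ 1 (f ∘ γ) (Icc a b) := by
    rw [← contMDiffOn_iff_contDiffOn]
    exact fun t ht ↦ ((hf t ht).comp t (hγ t)).contMDiffWithinAt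
  have h2 := enorm_sub_le_lintegral_deriv_of_contDiffOn_Icc h1 hab
  rw [Real.enorm_eq_ofReal_abs] at h2
  refine h2.trans ?_
  rw [g.len_eq, ← lintegral_const_mul' _ _ ENNReal.ofReal_ne_top]
  refine setLIntegral_mono' measurableSet_Icc fun t ht ↦ ?_
  rw [Real.enorm_eq_ofReal_abs, ← ENNReal.ofReal_mul hc0]
  refine ENNReal.ofReal_le_ofReal ?_
  refine le_trans (le_of_eq ?_) (hc t ht _)
  have h3 : mfderiv 𝓘(ℝ, ℝ) 𝓘(ℝ, ℝ) (f ∘ γ) t =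
      (mfderiv (𝓡∂ m) 𝓘(ℝ, ℝ) f (γ t)).comp (mfderiv 𝓘(ℝ, ℝ) (𝓡∂ m) γ t) :=
    mfderiv_comp t ((hf t ht).mdifferentiableAt one_ne_zero) ((hγ t).mdifferentiableAt one_ne_zero)
  rw [mfderiv_eq_fderiv] at h3
  congr 1
  exact congr($h3 (1 : ℝ))

variable {Y : Type*} [TopologicalSpace Y]
  [ChartedSpace (EuclideanHalfSpace m) Y] [IsManifold (𝓡∂ m) ∞ Y]

/-- Near `p`, the intrinsic distance is at most slightly more than the distance in the extended
chart at `p`, for the metric at `p`. -/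
theorem SmoothMetric.eventually_edist_le_nrm (g : SmoothMetric m X) (p : X) {r : ℝ}
    (hr : 1 < r) :
    ∀ᶠ z in 𝓝 (p, p), g.edist z.1 z.2 ≤ ENNReal.ofReal
      (r * g.nrm p (toTangent p (extChartAt (𝓡∂ m) p z.2 - extChartAt (𝓡∂ m) p z.1))) := by
  set ξ := extChartAt (𝓡∂ m) p with hξ
  let S := {y : X | ∀ v : TangentSpace (𝓡∂ m) y, g.nrm y v ≤ r * g.nrm p (chartDeriv p y v)}
  have hS : S ∈ 𝓝 p := (g.eventually_nrm_chartDeriv_le p hr).mono fun y hy v ↦ (hy v).2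
  obtain ⟨ρ, ρ0, hρ⟩ : ∃ ρ > 0, Metric.ball (ξ p) ρ ∩ range (𝓡∂ m) ⊆ ξ.target ∩ ξ.symm ⁻¹' S :=
    Metric.mem_nhdsWithin_iff.1 (inter_mem (extChartAt_target_mem_nhdsWithin p)
      (nhdsWithin_le_nhds ((continuousAt_extChartAt_symm p).preimage_mem_nhds
        (by rwa [extChartAt_to_inv]))))
  have hA : ∀ᶠ y in 𝓝 p, y ∈ ξ.source ∧ ξ y ∈ Metric.ball (ξ p) ρ ∩ range (𝓡∂ m) := by
    filter_upwards [extChartAt_source_mem_nhds (I := 𝓡∂ m) p,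
      (continuousAt_extChartAt (I := 𝓡∂ m) p).preimage_mem_nhds (Metric.ball_mem_nhds _ ρ0)]
      with y h1 h2
    exact ⟨h1, h2, extChartAt_target_subset_range p (ξ.map_source h1)⟩
  rw [nhds_prod_eq]
  filter_upwards [hA.prod_mk hA] with z ⟨⟨hx, hxb⟩, ⟨hy, hyb⟩⟩
  set a := ξ z.1 with ha
  set b := ξ z.2 with hb
  -- The segment stays in the ball and in the half-space, as both are convex; its length bounds the
  -- distance.
  let η : ℝ → EuclideanSpace ℝ (Fin m) := fun t ↦ a + t • (b - a)
  have hη : ∀ t ∈ Icc (0 : ℝ) 1, η t ∈ ξ.target ∩ ξ.symm ⁻¹' S := fun t ht ↦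
    hρ (((convex_ball _ _).inter (𝓡∂ m).convex_range).add_smul_sub_mem hxb hyb ht)
  have hηs : ContMDiff 𝓘(ℝ, ℝ) 𝓘(ℝ, EuclideanSpace ℝ (Fin m)) 1 η := by
    rw [contMDiff_iff_contDiff]
    fun_prop
  have hγ : ContMDiffOn 𝓘(ℝ, ℝ) (𝓡∂ m) 1 (ξ.symm ∘ η) (Icc 0 1) :=
    (contMDiffOn_extChartAt_symm p).comp hηs.contMDiffOn fun t ht ↦ (hη t ht).1
  have h0 : (ξ.symm ∘ η) 0 = z.1 := by simp [η, ha, ξ.left_inv hx]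
  have h1 : (ξ.symm ∘ η) 1 = z.2 := by simp [η, hb, ξ.left_inv hy]
  have hle := g.edist_le_len hγ zero_le_one
  rw [h0, h1] at hle
  refine hle.trans ?_
  -- The endpoints are dropped: the path is only known to be smooth on `[0, 1]` and need not be
  -- differentiable there.
  have hconst : ENNReal.ofReal (r * g.nrm p (toTangent p (b - a))) =
      ∫⁻ t in Ioo (0 : ℝ) 1, ENNReal.ofReal (r * g.nrm p (toTangent p (b - a))) := by simp
  rw [g.len_eq, ← restrict_Ioo_eq_restrict_Icc, hconst]
  refine setLIntegral_mono' measurableSet_Ioo fun t ht ↦ ENNReal.ofReal_le_ofReal ?_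
  have ht' := Ioo_subset_Icc_self ht
  have hst : ξ.symm (η t) ∈ ξ.source := ξ.map_target (hη t ht').1
  refine ((hη t ht').2 _).trans (le_of_eq ?_)
  congr 2
  have hγt : MDifferentiableAt 𝓘(ℝ, ℝ) (𝓡∂ m) (ξ.symm ∘ η) t :=
    (hγ.contMDiffAt (Icc_mem_nhds ht.1 ht.2)).mdifferentiableAt one_ne_zero
  have hξt : MDifferentiableAt (𝓡∂ m) 𝓘(ℝ, EuclideanSpace ℝ (Fin m)) ξ ((ξ.symm ∘ η) t) :=
    mdifferentiableAt_extChartAt (by rwa [← extChartAt_source (𝓡∂ m)])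
  have heq : ξ ∘ (ξ.symm ∘ η) =ᶠ[𝓝 t] η := by
    filter_upwards [Icc_mem_nhds ht.1 ht.2] with s hs using ξ.right_inv (hη s hs).1
  have hcomp := mfderiv_comp t hξt hγt
  have hd : HasDerivAt η (b - a) t := by
    simpa [η] using ((hasDerivAt_id t).smul_const (b - a)).const_add a
  rw [heq.mfderiv_eq, mfderiv_eq_fderiv] at hcomp
  have h2 : fderiv ℝ η t 1 = b - a := hd.deriv
  exact (congr($hcomp (1 : ℝ))).symm.trans h2

/-- Near `q`, the distance in the extended chart at `q` for the metric at `q` is at most slightly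
more than the intrinsic distance. -/
theorem SmoothMetric.eventually_nrm_le_edist [T2Space X] (g : SmoothMetric m X) (q : X) {r : ℝ}
    (hr : 1 < r) :
    ∀ᶠ z in 𝓝 (q, q), ENNReal.ofReal
      (g.nrm q (toTangent q (extChartAt (𝓡∂ m) q z.2 - extChartAt (𝓡∂ m) q z.1))) ≤
      ENNReal.ofReal r * g.edist z.1 z.2 := by
  have hr0 : 0 < r := by linarith
  set χ := extChartAt (𝓡∂ m) q with hχ
  obtain ⟨c, c0, hc⟩ := g.exists_edist_lt_subset (inter_mem
    (chart_source_mem_nhds (EuclideanHalfSpace m) q) (g.eventually_nrm_chartDeriv_le q hr))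
  have c4 : 0 < ENNReal.ofReal (c / 4) := ENNReal.ofReal_pos.2 (by positivity)
  rw [nhds_prod_eq]
  filter_upwards [(g.eventually_edist_lt q c4).prod_mk (g.eventually_edist_lt q c4)]
    with ⟨x, y⟩ ⟨hx, hy⟩
  dsimp only at hx hy ⊢
  -- Otherwise some path is shorter than both `g.nrm q w / r` and `c / 2`. It starts within `c / 4`
  -- of `q`, so it stays where the chart is almost isometric.
  by_contra! hlt
  set w := toTangent q (χ y - χ x) with hw
  have hw0 : 0 < g.nrm q w := by
    by_contra! h
    rw [ENNReal.ofReal_of_nonpos h] at hlt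
    exact not_lt_bot hlt
  have hd1 : g.edist x y < ENNReal.ofReal (g.nrm q w / r) := by
    rw [ENNReal.ofReal_div_of_pos hr0, ENNReal.lt_div_iff_mul_lt (by simp [hr0]) (by simp), mul_comm]
    exact hlt
  have hd2 : g.edist x y < ENNReal.ofReal (c / 2) := by
    calc g.edist x y ≤ g.edist x q + g.edist q y := g.edist_triangle _ _ _
      _ < ENNReal.ofReal (c / 4) + ENNReal.ofReal (c / 4) := by
        rw [g.edist_comm x q]
        exact ENNReal.add_lt_add hx hy
      _ = ENNReal.ofReal (c / 2) := by
        rw [← ENNReal.ofReal_add (by positivity) (by positivity)]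
        ring_nf
  obtain ⟨γ, h0, h1, hγ, hl⟩ := g.exists_len_lt (lt_min hd1 hd2)
  have hmem : ∀ t ∈ Icc (0 : ℝ) 1, γ t ∈ (chartAt (EuclideanHalfSpace m) q).source ∧
      ∀ v : TangentSpace (𝓡∂ m) (γ t), g.nrm q (chartDeriv q (γ t) v) ≤ r * g.nrm (γ t) v := by
    intro t ht
    have : g.edist q (γ t) < ENNReal.ofReal c := by
      calc g.edist q (γ t) ≤ g.edist q (γ 0) + g.edist (γ 0) (γ t) := g.edist_triangle _ _ _
        _ ≤ g.edist q (γ 0) + g.len γ 0 1 := by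
          gcongr
          exact (g.edist_le_len hγ.contMDiffOn ht.1).trans (g.len_mono γ le_rfl ht.2)
        _ < ENNReal.ofReal (c / 4) + ENNReal.ofReal (c / 2) := by
          rw [h0]
          exact ENNReal.add_lt_add hx (hl.trans_le (min_le_right _ _))
        _ ≤ ENNReal.ofReal c := by
          rw [← ENNReal.ofReal_add (by positivity) (by positivity)]
          exact ENNReal.ofReal_le_ofReal (by linarith)
    exact ⟨(hc _ this).1, fun v ↦ ((hc _ this).2 v).1⟩
  -- Pairing with `w` serves as a test function: its endpoint values differ by the square of the
  -- norm of `w`, more than the short path allows.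
  let B : EuclideanSpace ℝ (Fin m) →L[ℝ] ℝ := g.inner q w
  have hf : ∀ t ∈ Icc (0 : ℝ) 1, ContMDiffAt (𝓡∂ m) 𝓘(ℝ, ℝ) 1 (B ∘ χ) (γ t) := fun t ht ↦
    (B.contDiff.contMDiff.contMDiffAt).comp _ (contMDiffAt_extChartAt' (hmem t ht).1)
  have hdir (t) (ht : t ∈ Icc (0 : ℝ) 1) (v : TangentSpace (𝓡∂ m) (γ t)) :
      dirDeriv (B ∘ χ) (γ t) v = g.inner q w (chartDeriv q (γ t) v) := by
    have hB : MDifferentiableAt 𝓘(ℝ, EuclideanSpace ℝ (Fin m)) 𝓘(ℝ, ℝ) B (χ (γ t)) :=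
      B.mdifferentiableAt
    have hcomp := mfderiv_comp (γ t) hB
      (mdifferentiableAt_extChartAt (I := 𝓡∂ m) (hmem t ht).1)
    rw [B.mfderiv_eq] at hcomp
    exact congr($hcomp v)
  have hmain := g.abs_sub_le_len (c := g.nrm q w * r) zero_le_one hγ hf (fun t ht v ↦ by
    rw [hdir t ht, mul_assoc]
    exact (g.abs_inner_le _ _ _).trans
      (mul_le_mul_of_nonneg_left ((hmem t ht).2 v) hw0.le)) (by positivity)
  have hval : (B ∘ χ) (γ 1) - (B ∘ χ) (γ 0) = g.nrm q w ^ 2 := by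
    rw [h0, h1, g.nrm_sq]
    exact (map_sub B _ _).symm
  rw [hval, abs_of_nonneg (by positivity)] at hmain
  have : ENNReal.ofReal (g.nrm q w * r) * g.len γ 0 1 < ENNReal.ofReal (g.nrm q w ^ 2) := by
    calc _ < ENNReal.ofReal (g.nrm q w * r) * ENNReal.ofReal (g.nrm q w / r) := by
          refine ENNReal.mul_lt_mul_right ?_ ENNReal.ofReal_ne_top (hl.trans_le (min_le_left _ _))
          simp; positivity
      _ = _ := by
          rw [← ENNReal.ofReal_mul (by positivity)]
          congr 1
          field_simp
  exact this.not_ge hmain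

/-- In charts, a map that preserves the Riemannian metrics at `p` is almost isometric near `p`. -/
theorem eventually_nrm_le_nrm_map (g : SmoothMetric m X) (g' : SmoothMetric m Y) {j : X → Y}
    {p : X} (hj : ContMDiffAt (𝓡∂ m) (𝓡∂ m) 1 j p)
    (hiso : ∀ v : TangentSpace (𝓡∂ m) p,
      g'.nrm (j p) (mfderiv (𝓡∂ m) (𝓡∂ m) j p v) = g.nrm p v) {r : ℝ} (hr : 1 < r) :
    ∀ᶠ z in 𝓝 (p, p),
      g.nrm p (toTangent p (extChartAt (𝓡∂ m) p z.2 - extChartAt (𝓡∂ m) p z.1)) ≤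
      r * g'.nrm (j p) (toTangent (j p)
        (extChartAt (𝓡∂ m) (j p) (j z.2) - extChartAt (𝓡∂ m) (j p) (j z.1))) := by
  have hr0 : 0 < r := by linarith
  set ξ := extChartAt (𝓡∂ m) p with hξ
  set χ := extChartAt (𝓡∂ m) (j p) with hχ
  set h := writtenInExtChartAt (𝓡∂ m) (𝓡∂ m) p j
  obtain ⟨C₁, hC₁, H₁⟩ := g'.exists_nrm_le_norm (j p)
  obtain ⟨C₂, hC₂, H₂⟩ := g.exists_norm_le_nrm p
  have hd : ContDiffWithinAt ℝ 1 h (range (𝓡∂ m)) (ξ p) := (contMDiffAt_iff.1 hj).2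
  have hL : mfderiv (𝓡∂ m) (𝓡∂ m) j p = fderivWithin ℝ h (range (𝓡∂ m)) (ξ p) :=
    (hj.mdifferentiableAt one_ne_zero).mfderiv
  set L := fderivWithin ℝ h (range (𝓡∂ m)) (ξ p) with hLdef
  have hrr : 0 < 1 - r⁻¹ := by
    have := inv_lt_one_of_one_lt₀ hr
    linarith
  -- With this constant the linearization error is at most `1 - r⁻¹` times the norm of the chart
  -- difference, and can be absorbed.
  let K : ℝ≥0 := ⟨(1 - r⁻¹) / (C₁ * C₂), by positivity⟩
  have hK : 0 < K := by
    change 0 < (1 - r⁻¹) / (C₁ * C₂)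
    positivity
  obtain ⟨t, ht, hlip⟩ : ∃ t ∈ 𝓝[range (𝓡∂ m)] ξ p, LipschitzOnWith K (fun y ↦ h y - L y) t :=
    exists_lipschitzOnWith_sub_fderivWithin (𝓡∂ m).convex_range (mem_range_self _) ((𝓡∂ m).uniqueDiffOn _ (mem_range_self _)) hd hK
  have hA : ∀ᶠ y in 𝓝 p, y ∈ ξ.source ∧ ξ y ∈ t := by
    filter_upwards [extChartAt_source_mem_nhds (I := 𝓡∂ m) p,
      extChartAt_preimage_mem_nhds_of_mem_nhdsWithin (I := 𝓡∂ m) (mem_extChartAt_source p) ht]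
      with y h1 h2
    exact ⟨h1, h2⟩
  rw [nhds_prod_eq]
  filter_upwards [hA.prod_mk hA] with ⟨x, y⟩ ⟨⟨hx, hxt⟩, ⟨hy, hyt⟩⟩
  dsimp only at hx hxt hy hyt ⊢
  have hhx : h (ξ x) = χ (j x) := congrArg (fun z ↦ χ (j z)) (ξ.left_inv hx)
  have hhy : h (ξ y) = χ (j y) := congrArg (fun z ↦ χ (j z)) (ξ.left_inv hy)
  have hl := hlip.dist_le_mul _ hyt _ hxt
  rw [dist_eq_norm, dist_eq_norm, hhx, hhy] at hl
  set u := ξ y - ξ x with hu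
  set e := χ (j y) - χ (j x) with he
  have hl' : ‖L u - e‖ ≤ (1 - r⁻¹) / (C₁ * C₂) * ‖u‖ := by
    rw [norm_sub_rev]
    refine le_trans (le_of_eq ?_) hl
    congr 1
    rw [hu, he, map_sub]
    abel
  have h1 : g.nrm p (toTangent p u) = g'.nrm (j p) (toTangent (j p) (L u)) := by
    rw [← hiso, hL]
    rfl
  have h2 : g'.nrm (j p) (toTangent (j p) (L u)) ≤
      g'.nrm (j p) (toTangent (j p) e) + g'.nrm (j p) (toTangent (j p) (L u - e)) := by
    refine le_trans (le_of_eq ?_) (g'.nrm_add_le _ _ _)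
    congr 1
    exact (add_sub_cancel e (L u)).symm
  have h3 : g'.nrm (j p) (toTangent (j p) (L u - e)) ≤ (1 - r⁻¹) * g.nrm p (toTangent p u) := by
    calc _ ≤ C₁ * ‖L u - e‖ := H₁ _
      _ ≤ C₁ * ((1 - r⁻¹) / (C₁ * C₂) * (C₂ * g.nrm p (toTangent p u))) := by
        gcongr
        exact hl'.trans (mul_le_mul_of_nonneg_left (H₂ u) (by positivity))
      _ = _ := by field_simp
  have h4 : r⁻¹ * g.nrm p (toTangent p u) ≤ g'.nrm (j p) (toTangent (j p) e) := by linarith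
  rwa [inv_mul_le_iff₀ hr0] at h4

/-- For a map that preserves Riemannian metrics, the intrinsic distance in the source is locally
at most twice the distance of the images. -/
theorem eventually_edist_le_two_mul [T2Space Y] (g : SmoothMetric m X) (g' : SmoothMetric m Y)
    {j : X → Y} {p : X} (hj : ContMDiffAt (𝓡∂ m) (𝓡∂ m) 1 j p)
    (hiso : ∀ v : TangentSpace (𝓡∂ m) p,
      g'.nrm (j p) (mfderiv (𝓡∂ m) (𝓡∂ m) j p v) = g.nrm p v) :
    ∀ᶠ z in 𝓝 (p, p), g.edist z.1 z.2 ≤ 2 * g'.edist (j z.1) (j z.2) := by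
  -- Three comparisons lose a factor 5/4 each, and (5/4)³ = 125/64 < 2.
  have hr : (1 : ℝ) < 5 / 4 := by norm_num
  have hcont : Tendsto (fun z : X × X ↦ (j z.1, j z.2)) (𝓝 (p, p)) (𝓝 (j p, j p)) := by
    rw [nhds_prod_eq, nhds_prod_eq]
    exact hj.continuousAt.tendsto.prodMap hj.continuousAt.tendsto
  filter_upwards [g.eventually_edist_le_nrm p hr, eventually_nrm_le_nrm_map g g' hj hiso hr,
    hcont.eventually (g'.eventually_nrm_le_edist (j p) hr)] with z h1 h2 h3
  calc g.edist z.1 z.2 ≤ _ := h1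
    _ ≤ ENNReal.ofReal (5 / 4 * (5 / 4 * g'.nrm (j p) (toTangent (j p)
        (extChartAt (𝓡∂ m) (j p) (j z.2) - extChartAt (𝓡∂ m) (j p) (j z.1))))) :=
      ENNReal.ofReal_le_ofReal (by gcongr)
    _ = ENNReal.ofReal (5 / 4 * (5 / 4)) * ENNReal.ofReal (g'.nrm (j p) (toTangent (j p)
        (extChartAt (𝓡∂ m) (j p) (j z.2) - extChartAt (𝓡∂ m) (j p) (j z.1)))) := by
      rw [← mul_assoc, ENNReal.ofReal_mul (by norm_num)]
    _ ≤ ENNReal.ofReal (5 / 4 * (5 / 4)) *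
        (ENNReal.ofReal (5 / 4) * g'.edist (j z.1) (j z.2)) := by gcongr
    _ = ENNReal.ofReal (5 / 4 * (5 / 4) * (5 / 4)) * g'.edist (j z.1) (j z.2) := by
      rw [← mul_assoc, ← ENNReal.ofReal_mul (by norm_num)]
    _ ≤ 2 * g'.edist (j z.1) (j z.2) := by
      gcongr
      rw [← ENNReal.ofReal_ofNat 2]
      exact ENNReal.ofReal_le_ofReal (by norm_num)

/-! ### Radius functions and shadowing of paths -/

/-- The length of a path of finite length is the increment of a continuous function. -/
theorem SmoothMetric.exists_continuousOn_len (g : SmoothMetric m X) {γ : ℝ → X}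
    (h : g.len γ 0 1 ≠ ⊤) :
    ∃ l : ℝ → ℝ, MonotoneOn l (Icc 0 1) ∧ ContinuousOn l (Icc 0 1) ∧
      ∀ s ∈ Icc (0 : ℝ) 1, ∀ t ∈ Icc (0 : ℝ) 1, s ≤ t →
        g.len γ s t = ENNReal.ofReal (l t - l s) := by
  have hfin (s t : ℝ) (hs : 0 ≤ s) (ht : t ≤ 1) : g.len γ s t ≠ ⊤ :=
    ((g.len_mono γ hs ht).trans_lt h.lt_top).ne
  let l : ℝ → ℝ := fun t ↦ (g.len γ 0 t).toReal
  have hsub (s t : ℝ) (hs : s ∈ Icc (0 : ℝ) 1) (ht : t ∈ Icc (0 : ℝ) 1) (hst : s ≤ t) :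
      l t - l s = (g.len γ s t).toReal := by
    have := congrArg ENNReal.toReal (g.len_add γ hs.1 hst)
    rw [ENNReal.toReal_add (hfin _ _ le_rfl hs.2) (hfin _ _ hs.1 ht.2)] at this
    simp only [l]
    linarith
  have hmono : MonotoneOn l (Icc 0 1) := fun s hs t ht hst ↦ by
    have := hsub s t hs ht hst
    linarith [ENNReal.toReal_nonneg (a := g.len γ s t)]
  refine ⟨l, hmono, ?_, fun s hs t ht hst ↦ ?_⟩
  -- Absolute continuity of the integral of the speed.
  · have hunif : ∀ ε > 0, ∃ δ > 0, ∀ s ∈ Icc (0 : ℝ) 1, ∀ t ∈ Icc (0 : ℝ) 1, s ≤ t → t - s < δ →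
        l t - l s < ε := by
      intro ε hε
      rw [g.len_eq] at h
      obtain ⟨δ, δ0, hδ⟩ := exists_pos_setLIntegral_lt_of_measure_lt h (ENNReal.ofReal_pos.2 hε).ne'
      obtain ⟨δ', δ'0, hδ'⟩ := ENNReal.lt_iff_exists_nnreal_btwn.1 δ0
      refine ⟨δ', by simpa using δ'0, fun s hs t ht hst hlt ↦ ?_⟩
      rw [hsub s t hs ht hst]
      refine (ENNReal.toReal_lt_of_lt_ofReal ?_)
      have hi : Icc s t ∩ Icc 0 1 = Icc s t :=
        inter_eq_left.2 (Icc_subset_Icc hs.1 ht.2)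
      have := hδ (Icc s t) (by
        rw [Measure.restrict_apply measurableSet_Icc, hi, Real.volume_Icc]
        refine lt_of_le_of_lt ?_ hδ'
        rw [← ENNReal.ofReal_coe_nnreal]
        exact ENNReal.ofReal_le_ofReal hlt.le)
      rwa [Measure.restrict_restrict measurableSet_Icc, hi, ← g.len_eq] at this
    rw [Metric.continuousOn_iff]
    intro t ht ε hε
    obtain ⟨δ, δ0, hδ⟩ := hunif ε hε
    refine ⟨δ, δ0, fun s hs hst ↦ ?_⟩
    rw [Real.dist_eq, abs_lt] at hst ⊢
    rcases le_total s t with hle | hle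
    · have := hδ s hs t ht hle (by linarith)
      have := hmono hs ht hle
      constructor <;> linarith
    · have := hδ t ht s hs hle (by linarith)
      have := hmono ht hs hle
      constructor <;> linarith
  · rw [hsub s t hs ht hst, ENNReal.ofReal_toReal (hfin _ _ hs.1 ht.2)]

/-- A radius function along a map `j`: on the ball of radius `lam a` around `j a`, the intrinsic
distance of the source is at most twice the distance of the images. -/
structure IsRadius (g : SmoothMetric m X) (g' : SmoothMetric m Y) (j : X → Y) (lam : X → ℝ) :
    Prop where
  pos : ∀ a, 0 < lam a
  le_add : ∀ a b s, g'.edist (j a) (j b) ≤ ENNReal.ofReal s → 0 ≤ s → lam a ≤ lam b + s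
  edist_le : ∀ a b, g'.edist (j a) (j b) < ENNReal.ofReal (lam a) →
    g.edist a b ≤ 2 * g'.edist (j a) (j b)
  exists_isCompact : ∀ a, ∃ K : Set Y, IsCompact K ∧
    ∀ y, g'.edist (j a) y < ENNReal.ofReal (lam a) → y ∈ K

/-- The radius is half the supremum of the `r ≤ 1` that satisfy `Q`. A ball about `j a` contains the
balls about nearby `j b` with radius reduced by the distance; as `Q` concerns all pairs of points in
the ball, it passes to them, which gives the Lipschitz property. The cap 1 keeps the supremum
finite, and halving avoids asking whether it is attained. -/
theorem exists_isRadius [T2Space Y] (g : SmoothMetric m X) (g' : SmoothMetric m Y)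
    {j : X → Y} (hj : ContMDiff (𝓡∂ m) (𝓡∂ m) 1 j) (hemb : IsEmbedding j)
    (hiso : ∀ p, ∀ v : TangentSpace (𝓡∂ m) p,
      g'.nrm (j p) (mfderiv (𝓡∂ m) (𝓡∂ m) j p v) = g.nrm p v) :
    ∃ lam : X → ℝ, IsRadius g g' j lam := by
  have : LocallyCompactSpace Y := Manifold.locallyCompact_of_finiteDimensional (𝓡∂ m)
  let Q : X → ℝ → Prop := fun a r ↦
    (∀ x y, g'.edist (j a) (j x) < ENNReal.ofReal r → g'.edist (j a) (j y) < ENNReal.ofReal r →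
      g.edist x y ≤ 2 * g'.edist (j x) (j y)) ∧
    ∃ K : Set Y, IsCompact K ∧ ∀ y, g'.edist (j a) y < ENNReal.ofReal r → y ∈ K
  have hQ (a b : X) (r s : ℝ) (hs : 0 ≤ s) (hsr : s ≤ r)
      (h : g'.edist (j a) (j b) ≤ ENNReal.ofReal s) (hq : Q a r) : Q b (r - s) := by
    have key (y : Y) (hy : g'.edist (j b) y < ENNReal.ofReal (r - s)) :
        g'.edist (j a) y < ENNReal.ofReal r := by
      calc g'.edist (j a) y ≤ g'.edist (j a) (j b) + g'.edist (j b) y := g'.edist_triangle _ _ _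
        _ < ENNReal.ofReal s + ENNReal.ofReal (r - s) :=
          ENNReal.add_lt_add_of_le_of_lt (h.trans_lt ENNReal.ofReal_lt_top).ne h hy
        _ = ENNReal.ofReal r := by
          rw [← ENNReal.ofReal_add hs (by linarith)]
          congr 1
          ring
    obtain ⟨hq1, K, hK, hq2⟩ := hq
    exact ⟨fun x y hx hy ↦ hq1 x y (key _ hx) (key _ hy), K, hK, fun y hy ↦ hq2 y (key y hy)⟩
  let S : X → Set ℝ := fun a ↦ {r | 0 < r ∧ r ≤ 1 ∧ Q a r}
  have hbdd (a : X) : BddAbove (S a) := ⟨1, fun r hr ↦ hr.2.1⟩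
  have hne (a : X) : (S a).Nonempty := by
    have h1 := eventually_edist_le_two_mul g g' hj.contMDiffAt (hiso a)
    rw [nhds_prod_eq, eventually_prod_self_iff (r := fun x y ↦ g.edist x y ≤ 2 * g'.edist (j x) (j y))] at h1
    obtain ⟨t, ht, ht'⟩ := h1
    rw [hemb.isInducing.nhds_eq_comap, mem_comap] at ht
    obtain ⟨u, hu, hut⟩ := ht
    obtain ⟨K, hK, hKu⟩ := exists_compact_mem_nhds (j a)
    obtain ⟨c, c0, hc⟩ := g'.exists_edist_lt_subset (inter_mem hu hKu)
    have hmin : ENNReal.ofReal (min c 1) ≤ ENNReal.ofReal c :=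
      ENNReal.ofReal_le_ofReal (min_le_left _ _)
    exact ⟨min c 1, lt_min c0 one_pos, min_le_right _ _,
      fun x y hx hy ↦ ht' x (hut (hc _ (hx.trans_le hmin)).1) y (hut (hc _ (hy.trans_le hmin)).1),
      K, hK, fun y hy ↦ (hc _ (hy.trans_le hmin)).2⟩
  have hpos (a : X) : 0 < sSup (S a) := by
    obtain ⟨r, hr⟩ := hne a
    exact hr.1.trans_le (le_csSup (hbdd a) hr)
  have hlt (a : X) : Q a (sSup (S a) / 2) := by
    obtain ⟨r, hr, hlt⟩ := exists_lt_of_lt_csSup (hne a) (half_lt_self (hpos a))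
    have := hQ a a r (r - sSup (S a) / 2) (by linarith) (by linarith [hpos a])
      (by simp [g'.edist_self]) hr.2.2
    rwa [sub_sub_cancel] at this
  refine ⟨fun a ↦ sSup (S a) / 2, fun a ↦ half_pos (hpos a), fun a b s hs hs0 ↦ ?_,
    fun a b hab ↦ ?_, fun a ↦ (hlt a).2⟩
  · have : sSup (S a) ≤ sSup (S b) + s := by
      refine csSup_le (hne a) fun r hr ↦ ?_
      rcases le_or_gt r s with h | h
      · linarith [hpos b]
      · have := le_csSup (hbdd b) (show r - s ∈ S b from
          ⟨by linarith, by linarith [hr.2.1], hQ a b r s hs0 h.le hs hr.2.2⟩)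
        linarith
    linarith
  · refine (hlt a).1 a b ?_ hab
    rw [g'.edist_self]
    exact ENNReal.ofReal_pos.2 (half_pos (hpos a))

section

variable {g : SmoothMetric m X} {g' : SmoothMetric m Y} {j : X → Y} {lam : X → ℝ}

theorem IsRadius.edist_le_ofReal (h : IsRadius g g' j lam) {a b : X} {y z : Y} {s : ℝ}
    (ha : g'.edist y (j a) < ENNReal.ofReal (lam a / 8))
    (hb : g'.edist z (j b) < ENNReal.ofReal (lam b / 8))
    (hyz : g'.edist y z ≤ ENNReal.ofReal s) (hs : 0 ≤ s) :
    g'.edist (j a) (j b) ≤ ENNReal.ofReal (lam a / 8 + s + lam b / 8) := by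
  have := h.pos a
  have := h.pos b
  calc g'.edist (j a) (j b) ≤ g'.edist (j a) z + g'.edist z (j b) := g'.edist_triangle _ _ _
    _ ≤ g'.edist (j a) y + g'.edist y z + g'.edist z (j b) := by
      gcongr
      exact g'.edist_triangle _ _ _
    _ ≤ ENNReal.ofReal (lam a / 8) + ENNReal.ofReal s + ENNReal.ofReal (lam b / 8) := by
      rw [g'.edist_comm (j a) y]
      gcongr
    _ = _ := by
      rw [← ENNReal.ofReal_add (by positivity) hs, ← ENNReal.ofReal_add (by positivity) (by positivity)]

theorem IsRadius.abs_sub_le (h : IsRadius g g' j lam) {a b : X} {y z : Y} {s : ℝ}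
    (ha : g'.edist y (j a) < ENNReal.ofReal (lam a / 8))
    (hb : g'.edist z (j b) < ENNReal.ofReal (lam b / 8))
    (hyz : g'.edist y z ≤ ENNReal.ofReal s) (hs : 0 ≤ s) :
    |lam a - lam b| ≤ lam a / 8 + s + lam b / 8 := by
  have hp : 0 ≤ lam a / 8 + s + lam b / 8 := by linarith [h.pos a, h.pos b]
  have h1 := h.edist_le_ofReal ha hb hyz hs
  have h2 := h1
  rw [g'.edist_comm] at h2
  rw [abs_le]
  constructor
  · linarith [h.le_add b a _ h2 hp]
  · linarith [h.le_add a b _ h1 hp]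

/-- One step of the shadowing. The Lipschitz property makes the two radii comparable, so that `j a`
and `j b` are within `5/8 * lam a`, where distances at most double. -/
theorem IsRadius.edist_le_of_edist_le_div_four (h : IsRadius g g' j lam) {a b : X} {y z : Y}
    (ha : g'.edist y (j a) < ENNReal.ofReal (lam a / 8))
    (hb : g'.edist z (j b) < ENNReal.ofReal (lam b / 8))
    (hyz : g'.edist y z ≤ ENNReal.ofReal (lam a / 4)) :
    g.edist a b ≤ ENNReal.ofReal (5 / 4 * lam a) ∧ lam a ≤ 9 / 5 * lam b := by
  have hp := h.pos a
  have h1 := h.edist_le_ofReal ha hb hyz (by linarith)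
  have h2 := abs_le.1 (h.abs_sub_le ha hb hyz (by linarith))
  refine ⟨?_, by linarith⟩
  have h3 : g'.edist (j a) (j b) ≤ ENNReal.ofReal (5 / 8 * lam a) :=
    h1.trans (ENNReal.ofReal_le_ofReal (by linarith))
  calc g.edist a b ≤ 2 * g'.edist (j a) (j b) :=
        h.edist_le a b (h3.trans_lt ((ENNReal.ofReal_lt_ofReal_iff hp).2 (by linarith)))
    _ ≤ 2 * ENNReal.ofReal (5 / 8 * lam a) := by gcongr
    _ = ENNReal.ofReal (5 / 4 * lam a) := by
      rw [← ENNReal.ofReal_ofNat 2, ← ENNReal.ofReal_mul (by norm_num)]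
      congr 1
      ring

/-- A path of finite length that stays close to the image of `j` can be shadowed in the source
of `j`. -/
theorem IsRadius.edist_le_of_path (h : IsRadius g g' j lam) {γ : ℝ → Y} {l : ℝ → ℝ}
    (hmono : MonotoneOn l (Icc 0 1)) (hcont : ContinuousOn l (Icc 0 1))
    (hl : ∀ s ∈ Icc (0 : ℝ) 1, ∀ t ∈ Icc (0 : ℝ) 1, s ≤ t →
      g'.edist (γ s) (γ t) ≤ ENNReal.ofReal (l t - l s))
    (hnear : ∀ t ∈ Icc (0 : ℝ) 1, ∃ a, g'.edist (γ t) (j a) < ENNReal.ofReal (lam a / 8))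
    {a₀ b : X} (ha₀ : g'.edist (γ 0) (j a₀) < ENNReal.ofReal (lam a₀ / 8))
    (hb : g'.edist (γ 1) (j b) < ENNReal.ofReal (lam b / 8)) :
    g.edist a₀ b ≤ ENNReal.ofReal (5 * (l 1 - l 0) + 3 * lam b) := by
  have I0 : (0 : ℝ) ∈ Icc (0 : ℝ) 1 := ⟨le_rfl, zero_le_one⟩
  have I1 : (1 : ℝ) ∈ Icc (0 : ℝ) 1 := ⟨zero_le_one, le_rfl⟩
  -- Continuity method. A step of path length `lam a / 4` costs at most `5/4 * lam a` in the source,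
  -- which preserves the ratio 5.
  let T : Set ℝ := {t | t ∈ Icc (0 : ℝ) 1 ∧ ∃ a, g'.edist (γ t) (j a) < ENNReal.ofReal (lam a / 8) ∧
    g.edist a₀ a ≤ ENNReal.ofReal (5 * (l t - l 0))}
  have hT0 : (0 : ℝ) ∈ T := ⟨I0, a₀, ha₀, by simp [g.edist_self]⟩
  have hTb : BddAbove T := ⟨1, fun t ht ↦ ht.1.2⟩
  set t₀ := sSup T with ht₀
  have It₀ : t₀ ∈ Icc (0 : ℝ) 1 := ⟨le_csSup hTb hT0, csSup_le ⟨0, hT0⟩ fun t ht ↦ ht.1.2⟩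
  obtain ⟨a', ha'⟩ := hnear t₀ It₀
  have hp' := h.pos a'
  -- For `t` in `T` this close to the supremum, `lam a` is comparable to `lam a'`, so a full step of
  -- `lam a / 4` would pass beyond `t₀`.
  obtain ⟨δ, δ0, hδ⟩ := Metric.continuousOn_iff.1 hcont t₀ It₀ (lam a' / 32) (by positivity)
  obtain ⟨t, ht, htδ⟩ := exists_lt_of_lt_csSup ⟨0, hT0⟩ (show t₀ - δ < sSup T by linarith)
  have htt₀ : t ≤ t₀ := le_csSup hTb ht
  obtain ⟨It, a, ha, hda⟩ := ht
  have hp := h.pos a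
  have h0t : l 0 ≤ l t := hmono I0 It It.1
  have hlt : l t₀ - l t < lam a' / 32 := by
    have := hδ t It (by rw [Real.dist_eq, abs_lt]; constructor <;> linarith)
    rw [Real.dist_eq, abs_lt] at this
    linarith
  have hcmp := abs_le.1 (h.abs_sub_le ha ha' ((hl t It t₀ It₀ htt₀).trans
    (ENNReal.ofReal_le_ofReal hlt.le)) (by positivity))
  rcases lt_or_ge (l 1 - l t) (lam a / 4) with hcase | hcase
  -- The last, incomplete step costs `5/4 * lam a ≤ 9/4 * lam b`, within the allowance `3 * lam b`.
  · obtain ⟨h1, h2⟩ := h.edist_le_of_edist_le_div_four ha hb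
      ((hl t It 1 I1 It.2).trans (ENNReal.ofReal_le_ofReal hcase.le))
    have ht1 : l t ≤ l 1 := hmono It I1 It.2
    calc g.edist a₀ b ≤ g.edist a₀ a + g.edist a b := g.edist_triangle _ _ _
      _ ≤ ENNReal.ofReal (5 * (l t - l 0)) + ENNReal.ofReal (5 / 4 * lam a) := by gcongr
      _ ≤ _ := by
        rw [← ENNReal.ofReal_add (by linarith) (by positivity)]
        exact ENNReal.ofReal_le_ofReal (by linarith)
  · exfalso
    obtain ⟨s, hs, hls⟩ := intermediate_value_Icc It.2
      (hcont.mono (Icc_subset_Icc It.1 le_rfl))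
      (show l t + lam a / 4 ∈ Icc (l t) (l 1) from ⟨by linarith, by linarith⟩)
    have Is : s ∈ Icc (0 : ℝ) 1 := ⟨It.1.trans hs.1, hs.2⟩
    obtain ⟨c, hc⟩ := hnear s Is
    obtain ⟨h1, -⟩ := h.edist_le_of_edist_le_div_four ha hc
      ((hl t It s Is hs.1).trans (ENNReal.ofReal_le_ofReal (by linarith)))
    have hsT : s ∈ T := by
      refine ⟨Is, c, hc, ?_⟩
      calc g.edist a₀ c ≤ g.edist a₀ a + g.edist a c := g.edist_triangle _ _ _
        _ ≤ ENNReal.ofReal (5 * (l t - l 0)) + ENNReal.ofReal (5 / 4 * lam a) := by gcongr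
        _ ≤ _ := by
          rw [← ENNReal.ofReal_add (by linarith) (by positivity)]
          exact ENNReal.ofReal_le_ofReal (by linarith)
    have := hmono Is It₀ (le_csSup hTb hsT)
    linarith

end

/-! ### Conformal deformations -/

set_option synthInstance.maxHeartbeats 200000 in
/-- The conformal deformation `e^{2φ} g` of a Riemannian metric `g`. -/
def SmoothMetric.conformal (g : SmoothMetric m X) (φ : X → ℝ)
    (hφ : ContMDiff (𝓡∂ m) 𝓘(ℝ, ℝ) ∞ φ) : SmoothMetric m X where
  inner x := Real.exp (2 * φ x) • g.inner x
  symm x v w := by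
    change Real.exp (2 * φ x) * g.inner x v w = Real.exp (2 * φ x) * g.inner x w v
    rw [g.symm]
  pos x v hv := mul_pos (Real.exp_pos _) (g.pos x v hv)
  isVonNBounded x := by
    have hc : (0 : ℝ) < Real.exp (φ x) := Real.exp_pos _
    -- The new unit ball is the old one scaled by `e^{-φ}`.
    have := (g.isVonNBounded x).image
      ((Real.exp (φ x))⁻¹ • ContinuousLinearMap.id ℝ (TangentSpace (𝓡∂ m) x))
    refine this.subset fun v (hv : Real.exp (2 * φ x) * g.inner x v v < 1) ↦ ?_
    refine ⟨Real.exp (φ x) • v, ?_, inv_smul_smul₀ hc.ne' v⟩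
    change g.inner x (Real.exp (φ x) • v) (Real.exp (φ x) • v) < 1
    rw [two_mul, Real.exp_add] at hv
    simpa [mul_assoc] using hv
  contMDiff := by
    have h : ContMDiff (𝓡∂ m) 𝓘(ℝ, ℝ) ∞ fun x ↦ Real.exp (2 * φ x) :=
      (Real.contDiff_exp.comp (contDiff_const.mul contDiff_id)).contMDiff.comp hφ
    exact ContMDiff.smul_section
      (V := fun x : X ↦ TangentSpace (𝓡∂ m) x →L[ℝ] TangentSpace (𝓡∂ m) x →L[ℝ] ℝ) h g.contMDiff

theorem SmoothMetric.conformal_inner (g : SmoothMetric m X) {φ : X → ℝ}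
    (hφ : ContMDiff (𝓡∂ m) 𝓘(ℝ, ℝ) ∞ φ) (x : X) (v w : TangentSpace (𝓡∂ m) x) :
    (g.conformal φ hφ).inner x v w = Real.exp (2 * φ x) * g.inner x v w := rfl

theorem SmoothMetric.nrm_conformal (g : SmoothMetric m X) {φ : X → ℝ}
    (hφ : ContMDiff (𝓡∂ m) 𝓘(ℝ, ℝ) ∞ φ) (x : X) (v : TangentSpace (𝓡∂ m) x) :
    (g.conformal φ hφ).nrm x v = Real.exp (φ x) * g.nrm x v := by
  unfold SmoothMetric.nrm
  rw [g.conformal_inner, two_mul, Real.exp_add, Real.sqrt_mul (by positivity),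
    Real.sqrt_mul_self (Real.exp_pos _).le]

theorem SmoothMetric.len_le_len_conformal (g : SmoothMetric m X) {φ : X → ℝ}
    (hφ : ContMDiff (𝓡∂ m) 𝓘(ℝ, ℝ) ∞ φ) (h0 : ∀ x, 0 ≤ φ x) (γ : ℝ → X) (a b : ℝ) :
    g.len γ a b ≤ (g.conformal φ hφ).len γ a b := by
  rw [g.len_eq, SmoothMetric.len_eq]
  refine lintegral_mono fun t ↦ ENNReal.ofReal_le_ofReal ?_
  rw [g.nrm_conformal]
  exact le_mul_of_one_le_left (g.nrm_nonneg _ _) (Real.one_le_exp (h0 _))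

/-! ### Bounds on differentials and an exhaustion function -/

/-- The differential of a smooth function is locally bounded. -/
theorem SmoothMetric.exists_eventually_abs_dirDeriv_le (g : SmoothMetric m X) {f : X → ℝ}
    (hf : ContMDiff (𝓡∂ m) 𝓘(ℝ, ℝ) 1 f) (x : X) :
    ∃ c : ℝ, 0 ≤ c ∧ ∀ᶠ y in 𝓝 x, ∀ v : TangentSpace (𝓡∂ m) y,
      |dirDeriv f y v| ≤ c * g.nrm y v := by
  set χ := extChartAt (𝓡∂ m) x
  set h : EuclideanSpace ℝ (Fin m) → ℝ := f ∘ χ.symm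
  have hd : ContDiffWithinAt ℝ 1 h (range (𝓡∂ m)) (χ x) := (contMDiffAt_iff.1 (hf x)).2
  obtain ⟨C, C0, hC⟩ := g.exists_norm_le_nrm x
  have hd' : ContDiffWithinAt ℝ (0 + 1) h (range (𝓡∂ m)) (χ x) := by simpa using hd
  obtain ⟨u, hu, -, -, f', hf', hc⟩ :=
    (contDiffWithinAt_succ_iff_hasFDerivWithinAt' (by simp)).1 hd'
  rw [insert_eq_of_mem (show χ x ∈ range (𝓡∂ m) from mem_range_self _)] at hu
  have hbd : ∀ᶠ z in 𝓝[range (𝓡∂ m)] (χ x), ‖f' z‖ < ‖f' (χ x)‖ + 1 :=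
    hc.continuousWithinAt.norm.eventually_lt continuousWithinAt_const (by simp)
  refine ⟨(‖f' (χ x)‖ + 1) * (C * 2), by positivity, ?_⟩
  filter_upwards [chart_source_mem_nhds (EuclideanHalfSpace m) x,
    extChartAt_preimage_mem_nhds_of_mem_nhdsWithin (I := 𝓡∂ m) (mem_extChartAt_source x)
      (inter_mem hu hbd),
    g.eventually_nrm_chartDeriv_le x one_lt_two] with y hy hyu hyd v
  have hys : y ∈ χ.source := by rwa [extChartAt_source]
  have h1 : HasMFDerivAt (𝓡∂ m) 𝓘(ℝ, EuclideanSpace ℝ (Fin m)) χ y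
      (mfderiv (𝓡∂ m) 𝓘(ℝ, EuclideanSpace ℝ (Fin m)) χ y) :=
    (mdifferentiableAt_extChartAt hy).hasMFDerivAt
  have h2 : HasMFDerivWithinAt 𝓘(ℝ, EuclideanSpace ℝ (Fin m)) 𝓘(ℝ, ℝ) h (range (𝓡∂ m)) (χ y)
      (f' (χ y)) := (hf' (χ y) hyu.1).hasMFDerivWithinAt
  have h3 := HasMFDerivWithinAt.comp y h2 h1.hasMFDerivWithinAt
    (s := univ) fun z _ ↦ mem_range_self _
  rw [hasMFDerivWithinAt_univ] at h3
  have heq : f =ᶠ[𝓝 y] h ∘ χ := by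
    filter_upwards [extChartAt_source_mem_nhds' (I := 𝓡∂ m) hys] with z hz
    exact (congrArg f (χ.left_inv hz)).symm
  obtain ⟨w, hw⟩ : ∃ w : EuclideanSpace ℝ (Fin m), toTangent x w = chartDeriv x y v := ⟨_, rfl⟩
  have h4 : dirDeriv f y v = f' (χ y) w :=
    (congr($((h3.congr_of_eventuallyEq heq).mfderiv) v)).trans (congrArg (f' (χ y)) hw.symm)
  have h5 : ‖w‖ ≤ C * (2 * g.nrm y v) :=
    (hC w).trans (mul_le_mul_of_nonneg_left (hw ▸ (hyd v).1) C0.le)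
  have h6 : ‖f' (χ y)‖ ≤ ‖f' (χ x)‖ + 1 := le_of_lt hyu.2
  rw [h4]
  calc |f' (χ y) w| ≤ ‖f' (χ y)‖ * ‖w‖ := (f' (χ y)).le_opNorm _
    _ ≤ (‖f' (χ x)‖ + 1) * (C * (2 * g.nrm y v)) := by gcongr
    _ = _ := by ring

/-- There is a smooth function that bounds the differentials of two given functions. -/
theorem SmoothMetric.exists_contMDiff_abs_dirDeriv_le [T2Space X] [SigmaCompactSpace X]
    (g : SmoothMetric m X) {f₁ f₂ : X → ℝ} (hf₁ : ContMDiff (𝓡∂ m) 𝓘(ℝ, ℝ) 1 f₁)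
    (hf₂ : ContMDiff (𝓡∂ m) 𝓘(ℝ, ℝ) 1 f₂) :
    ∃ ψ : X → ℝ, ContMDiff (𝓡∂ m) 𝓘(ℝ, ℝ) ∞ ψ ∧ ∀ x, 0 ≤ ψ x ∧ ∀ v : TangentSpace (𝓡∂ m) x,
      |dirDeriv f₁ x v| ≤ ψ x * g.nrm x v ∧ |dirDeriv f₂ x v| ≤ ψ x * g.nrm x v := by
  -- The admissible bounds at a point form a convex set and constants are admissible locally, so a
  -- partition of unity glues them.
  obtain ⟨ψ, hψ⟩ := exists_contMDiffMap_forall_mem_convex_of_local_const (n := (⊤ : ℕ∞)) (𝓡∂ m)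
    (t := fun x ↦ {c : ℝ | 0 ≤ c ∧ ∀ v : TangentSpace (𝓡∂ m) x,
      |dirDeriv f₁ x v| ≤ c * g.nrm x v ∧ |dirDeriv f₂ x v| ≤ c * g.nrm x v}) (fun x ↦ by
      refine Set.OrdConnected.convex ⟨fun a ha b hb c hc ↦ ⟨ha.1.trans hc.1, fun v ↦ ?_⟩⟩
      have := mul_le_mul_of_nonneg_right hc.1 (g.nrm_nonneg x v)
      exact ⟨(ha.2 v).1.trans this, (ha.2 v).2.trans this⟩) (fun x ↦ by
      obtain ⟨c₁, h₁, H₁⟩ := g.exists_eventually_abs_dirDeriv_le hf₁ x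
      obtain ⟨c₂, h₂, H₂⟩ := g.exists_eventually_abs_dirDeriv_le hf₂ x
      refine ⟨max c₁ c₂, ?_⟩
      filter_upwards [H₁, H₂] with y hy₁ hy₂
      refine ⟨h₁.trans (le_max_left _ _), fun v ↦ ⟨(hy₁ v).trans ?_, (hy₂ v).trans ?_⟩⟩
      · exact mul_le_mul_of_nonneg_right (le_max_left _ _) (g.nrm_nonneg _ _)
      · exact mul_le_mul_of_nonneg_right (le_max_right _ _) (g.nrm_nonneg _ _))
  exact ⟨ψ, ψ.contMDiff, hψ⟩

/-- A σ-compact manifold has a smooth exhaustion function. -/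
theorem exists_contMDiff_isCompact_le [T2Space X] [SigmaCompactSpace X] [LocallyCompactSpace X] :
    ∃ ρ : X → ℝ, ContMDiff (𝓡∂ m) 𝓘(ℝ, ℝ) ∞ ρ ∧ ∀ c, IsCompact {x | ρ x ≤ c} := by
  let K : CompactExhaustion X := default
  -- A smooth majorant of the index of the first compact set containing `x`; near `x` this index is
  -- at most `K.find x + 1`.
  obtain ⟨ρ, hρ⟩ := exists_contMDiffMap_forall_mem_convex_of_local_const (n := (⊤ : ℕ∞)) (𝓡∂ m)
    (t := fun x : X ↦ Ici (K.find x : ℝ)) (fun x ↦ convex_Ici _) (fun x ↦ by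
      refine ⟨(K.find x + 1 : ℕ), ?_⟩
      filter_upwards [isOpen_interior.mem_nhds
        (K.subset_interior_succ _ (K.mem_find x))] with y hy
      exact (Nat.cast_le (α := ℝ)).2 <| K.mem_iff_find_le.1 (interior_subset hy))
  refine ⟨ρ, ρ.contMDiff, fun c ↦ ?_⟩
  refine (K.isCompact ⌈c⌉₊).of_isClosed_subset
    (isClosed_le ρ.contMDiff.continuous continuous_const) fun x (hx : ρ x ≤ c) ↦ ?_
  rw [K.mem_iff_find_le]
  exact (Nat.cast_le (α := ℝ)).1 <| ((hρ x).trans hx).trans (Nat.le_ceil c)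

/-! ### Openness at interior points -/

omit [IsManifold (𝓡∂ m) ∞ X] [IsManifold (𝓡∂ m) ∞ Y] in
/-- A map with injective differential at an interior point maps neighborhoods of this point to
neighborhoods of its image. -/
theorem image_mem_nhds_of_isInteriorPoint {j : X → Y} {p : X}
    (hj : ContMDiffAt (𝓡∂ m) (𝓡∂ m) 1 j p) (hp : (𝓡∂ m).IsInteriorPoint p)
    (hinj : ∀ v : TangentSpace (𝓡∂ m) p, mfderiv (𝓡∂ m) (𝓡∂ m) j p v = 0 → v = 0) :
    range j ∈ 𝓝 (j p) := by
  set ξ := extChartAt (𝓡∂ m) p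
  set χ := extChartAt (𝓡∂ m) (j p)
  set h := writtenInExtChartAt (𝓡∂ m) (𝓡∂ m) p j
  have hr : range (𝓡∂ m) ∈ 𝓝 (ξ p) := mem_interior_iff_mem_nhds.1 hp
  have hd : ContDiffAt ℝ 1 h (ξ p) := (contMDiffAt_iff.1 hj).2.contDiffAt hr
  have hL : mfderiv (𝓡∂ m) (𝓡∂ m) j p = fderiv ℝ h (ξ p) :=
    (hj.mdifferentiableAt one_ne_zero).mfderiv.trans (fderivWithin_of_mem_nhds hr)
  have hinj' : LinearMap.ker (fderiv ℝ h (ξ p)).toLinearMap = ⊥ := by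
    rw [LinearMap.ker_eq_bot']
    intro v hv
    exact hinj v (congr($hL v).trans hv)
  -- Equal finite dimensions turn injectivity into surjectivity, so `h` is open at `ξ p`. That `j p`
  -- is interior is not needed.
  have hsurj : LinearMap.range (fderiv ℝ h (ξ p)).toLinearMap = ⊤ := by
    rw [LinearMap.range_eq_top]
    exact LinearMap.injective_iff_surjective.1 (LinearMap.ker_eq_bot.1 hinj')
  have hopen : Filter.map h (𝓝 (ξ p)) = 𝓝 (h (ξ p)) :=
    (hd.hasStrictFDerivAt one_ne_zero).map_nhds_eq_of_surj hsurj
  have hhp : h (ξ p) = χ (j p) := congrArg (fun z ↦ χ (j z)) (extChartAt_to_inv p)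
  have hs : {z | j (ξ.symm z) ∈ χ.source} ∈ 𝓝 (ξ p) := by
    have hc : ContinuousAt (j ∘ ξ.symm) (ξ p) := by
      refine ContinuousAt.comp ?_ (continuousAt_extChartAt_symm p)
      rw [extChartAt_to_inv]
      exact hj.continuousAt
    refine hc.preimage_mem_nhds ?_
    rw [Function.comp_apply, extChartAt_to_inv]
    exact extChartAt_source_mem_nhds _
  have himg : h '' {z | j (ξ.symm z) ∈ χ.source} ∈ 𝓝 (χ (j p)) := by
    rw [← hhp, ← hopen]
    exact image_mem_map hs
  filter_upwards [(continuousAt_extChartAt (I := 𝓡∂ m) (j p)).preimage_mem_nhds himg,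
    extChartAt_source_mem_nhds (I := 𝓡∂ m) (j p)] with q ⟨z, hz, hzq⟩ hq
  exact ⟨ξ.symm z, χ.injOn hz hq hzq⟩

/-! ### Cauchy sequences and completeness -/

/-- A sequence that is Cauchy for the intrinsic distance. -/
def SmoothMetric.IsCauchy (g : SmoothMetric m X) (u : ℕ → X) : Prop :=
  ∀ c : ℝ, 0 < c → ∃ n₀, ∀ k ≥ n₀, ∀ n ≥ n₀, g.edist (u k) (u n) < ENNReal.ofReal c

theorem SmoothMetric.IsCauchy.exists_tendsto_of_frequently_mem [T2Space X] {g : SmoothMetric m X}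
    {u : ℕ → X} (hu : g.IsCauchy u) {K : Set X} (hK : IsCompact K) (h : ∃ᶠ n in atTop, u n ∈ K) :
    ∃ x, Tendsto u atTop (𝓝 x) := by
  obtain ⟨x, -, hx⟩ := hK.exists_mapClusterPt_of_frequently h
  refine ⟨x, g.tendsto_of_edist fun c hc ↦ ?_⟩
  have hc2 : 0 < ENNReal.ofReal (c / 2) := ENNReal.ofReal_pos.2 (by positivity)
  obtain ⟨n₀, hn₀⟩ := hu (c / 2) (by positivity)
  obtain ⟨k, hk, hkn⟩ := ((mapClusterPt_iff_frequently.1 hx _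
    (g.eventually_edist_lt x hc2)).and_eventually (eventually_ge_atTop n₀)).exists
  filter_upwards [eventually_ge_atTop n₀] with n hn
  calc g.edist x (u n) ≤ g.edist x (u k) + g.edist (u k) (u n) := g.edist_triangle _ _ _
    _ < ENNReal.ofReal (c / 2) + ENNReal.ofReal (c / 2) := ENNReal.add_lt_add hk (hn₀ k hkn n hn)
    _ = ENNReal.ofReal c := by
      rw [← ENNReal.ofReal_add (by positivity) (by positivity), add_halves]

omit [IsManifold (𝓡∂ m) ∞ X] in
theorem dirDeriv_sq {f : X → ℝ} {y : X} (hf : MDifferentiableAt (𝓡∂ m) 𝓘(ℝ, ℝ) f y)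
    (v : TangentSpace (𝓡∂ m) y) :
    dirDeriv (fun x ↦ f x ^ 2) y v = 2 * f y * dirDeriv f y v := by
  have h1 : HasFDerivAt (fun s : ℝ ↦ s ^ 2) (ContinuousLinearMap.toSpanSingleton ℝ (2 * f y)) (f y) := by
    simpa using (hasDerivAt_pow 2 (f y)).hasFDerivAt
  have h2 := HasMFDerivAt.comp y h1.hasMFDerivAt hf.hasMFDerivAt
  refine (congr($(h2.mfderiv) v)).trans ?_
  change dirDeriv f y v * (2 * f y) = _
  ring

/-- A sequence that stays close to the image of `j` and is Cauchy for a metric `g₁` larger than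
`g'` converges, if the source of `j` is complete and short paths between its points stay close to
the image of `j`. -/
theorem IsRadius.exists_tendsto [T2Space X] [T2Space Y] {g : SmoothMetric m X}
    {g' g₁ : SmoothMetric m Y}
    {j : X → Y} {lam : X → ℝ} (h : IsRadius g g' j lam) (hg : IsCompleteMetric g)
    (hj : Continuous j) (hlen : ∀ γ a b, g'.len γ a b ≤ g₁.len γ a b) {u : ℕ → Y}
    (hu : g₁.IsCauchy u)
    (hpath : ∀ k n, ∀ R : ℝ≥0∞, g₁.edist (u k) (u n) < R → ∃ γ : ℝ → Y,
      γ 0 = u k ∧ γ 1 = u n ∧ ContMDiff 𝓘(ℝ, ℝ) (𝓡∂ m) 1 γ ∧ g₁.len γ 0 1 < R ∧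
      ∀ t ∈ Icc (0 : ℝ) 1, ∃ a, g'.edist (γ t) (j a) < ENNReal.ofReal (lam a / 8))
    (hnear : ∀ n, ∃ a, g'.edist (u n) (j a) < ENNReal.ofReal (lam a / 8)) :
    ∃ x, Tendsto u atTop (𝓝 x) := by
  choose a ha using hnear
  have hdist (k n : ℕ) : g'.edist (u k) (u n) ≤ g₁.edist (u k) (u n) := by
    refine le_of_forall_gt fun R hR ↦ ?_
    obtain ⟨γ, h0, h1, hγ, hl, -⟩ := hpath k n R hR
    rw [← h0, ← h1]
    exact ((g'.edist_le_len hγ.contMDiffOn zero_le_one).trans (hlen _ _ _)).trans_lt hl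
  -- If the radii do not tend to 0, one ball of radius `lam (a n)` with relatively compact interior
  -- contains a tail, since `lam (a n) / 8 + c / 2 ≤ lam (a n)`. Otherwise the sequence is
  -- asymptotic to its shadow.
  by_cases hcase : ∃ c > 0, ∀ n₀, ∃ n ≥ n₀, c ≤ lam (a n)
  · obtain ⟨c, c0, hc⟩ := hcase
    obtain ⟨n₁, hn₁⟩ := hu (c / 2) (by positivity)
    obtain ⟨n, hn, hcn⟩ := hc n₁
    obtain ⟨K, hK, hKn⟩ := h.exists_isCompact (a n)
    refine hu.exists_tendsto_of_frequently_mem hK (Eventually.frequently ?_)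
    filter_upwards [eventually_ge_atTop n₁] with k hk
    refine hKn _ ?_
    calc g'.edist (j (a n)) (u k) ≤ g'.edist (j (a n)) (u n) + g'.edist (u n) (u k) :=
          g'.edist_triangle _ _ _
      _ < ENNReal.ofReal (lam (a n) / 8) + ENNReal.ofReal (c / 2) := by
        rw [g'.edist_comm (j (a n))]
        exact ENNReal.add_lt_add (ha n) ((hdist _ _).trans_lt (hn₁ n hn k hk))
      _ ≤ ENNReal.ofReal (lam (a n)) := by
        rw [← ENNReal.ofReal_add (by linarith) (by linarith)]
        exact ENNReal.ofReal_le_ofReal (by linarith)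
  · push Not at hcase
    -- Shadowing bounds the distance by `5 * (c / 16) + 3 * (c / 16) = c / 2`.
    have hcau : ∀ c : ℝ, 0 < c →
        ∃ n₀, ∀ k ≥ n₀, ∀ n ≥ n₀, g.edist (a k) (a n) < ENNReal.ofReal c := by
      intro c c0
      obtain ⟨n₁, hn₁⟩ := hcase (c / 16) (by positivity)
      obtain ⟨n₂, hn₂⟩ := hu (c / 16) (by positivity)
      refine ⟨max n₁ n₂, fun k hk n hn ↦ ?_⟩
      obtain ⟨γ, h0, h1, hγ, hl, hγn⟩ := hpath k n _
        (hn₂ k ((le_max_right _ _).trans hk) n ((le_max_right _ _).trans hn))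
      have hl' := (hlen γ 0 1).trans_lt hl
      obtain ⟨l, hmono, hcont, hls⟩ := g'.exists_continuousOn_len (hl'.trans_le le_top).ne
      rw [hls 0 ⟨le_rfl, zero_le_one⟩ 1 ⟨zero_le_one, le_rfl⟩ zero_le_one,
        ENNReal.ofReal_lt_ofReal_iff (by positivity)] at hl'
      refine (h.edist_le_of_path hmono hcont (fun s hs t ht hst ↦ ?_) hγn (a₀ := a k) (b := a n)
        (by rw [h0]; exact ha k) (by rw [h1]; exact ha n)).trans_lt ?_
      · rw [← hls s hs t ht hst]
        exact g'.edist_le_len hγ.contMDiffOn hst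
      · have := hn₁ n ((le_max_left _ _).trans hn)
        exact (ENNReal.ofReal_lt_ofReal_iff c0).2 (by linarith)
    obtain ⟨x, hx⟩ := (isCompleteMetric_iff g).1 hg a hcau
    refine ⟨j x, g'.tendsto_of_edist fun c c0 ↦ ?_⟩
    obtain ⟨n₁, hn₁⟩ := hcase (c / 2) (by positivity)
    have c2 : 0 < ENNReal.ofReal (c / 2) := ENNReal.ofReal_pos.2 (by positivity)
    filter_upwards [((hj.tendsto x).comp hx).eventually (g'.eventually_edist_lt (j x) c2),
      eventually_ge_atTop n₁] with n hn hn'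
    calc g'.edist (j x) (u n) ≤ g'.edist (j x) (j (a n)) + g'.edist (j (a n)) (u n) :=
          g'.edist_triangle _ _ _
      _ < ENNReal.ofReal (c / 2) + ENNReal.ofReal (lam (a n) / 8) := by
        rw [g'.edist_comm (j (a n))]
        exact ENNReal.add_lt_add hn (ha n)
      _ ≤ ENNReal.ofReal c := by
        have := hn₁ n hn'
        rw [← ENNReal.ofReal_add (by positivity) (by linarith [h.pos (a n)])]
        exact ENNReal.ofReal_le_ofReal (by linarith [h.pos (a n)])

/-- Completeness of the conformal deformation `e^{2φ} g'`, `φ = 2 f ψ`, where `f` vanishes on the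
image of `j` and `ψ` bounds the differentials of `f` and of an exhaustion function. -/
theorem IsRadius.isCompleteMetric_conformal [T2Space X] [T2Space Y] {g : SmoothMetric m X}
    {g' : SmoothMetric m Y} {j : X → Y} {lam : X → ℝ} (h : IsRadius g g' j lam)
    (hg : IsCompleteMetric g) (hj : Continuous j) {f ρ ψ : Y → ℝ}
    (hf : ContMDiff (𝓡∂ m) 𝓘(ℝ, ℝ) ∞ f) (hρ : ContMDiff (𝓡∂ m) 𝓘(ℝ, ℝ) ∞ ρ)
    (hf01 : ∀ y, f y ∈ Icc (0 : ℝ) 1)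
    (hf1 : ∀ y, f y ≠ 1 → ∃ a, g'.edist y (j a) < ENNReal.ofReal (lam a / 8))
    (hcpt : ∀ c, IsCompact {y | ρ y ≤ c})
    (hψ0 : ∀ y, 0 ≤ ψ y)
    (hψf : ∀ y, ∀ v : TangentSpace (𝓡∂ m) y, |dirDeriv f y v| ≤ ψ y * g'.nrm y v)
    (hψρ : ∀ y, ∀ v : TangentSpace (𝓡∂ m) y, |dirDeriv ρ y v| ≤ ψ y * g'.nrm y v)
    (hφ : ContMDiff (𝓡∂ m) 𝓘(ℝ, ℝ) ∞ fun y ↦ 2 * f y * ψ y) :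
    IsCompleteMetric (g'.conformal (fun y ↦ 2 * f y * ψ y) hφ) := by
  have hφ0 (y : Y) : 0 ≤ 2 * f y * ψ y :=
    mul_nonneg (mul_nonneg zero_le_two (hf01 y).1) (hψ0 y)
  set g₁ := g'.conformal (fun y ↦ 2 * f y * ψ y) hφ with hg₁
  have hnrm (y : Y) (v : TangentSpace (𝓡∂ m) y) : 2 * f y * ψ y * g'.nrm y v ≤ g₁.nrm y v := by
    rw [hg₁, g'.nrm_conformal]
    have := Real.add_one_le_exp (2 * f y * ψ y)
    exact mul_le_mul_of_nonneg_right (by linarith) (g'.nrm_nonneg y v)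
  have hf2 : ContMDiff (𝓡∂ m) 𝓘(ℝ, ℝ) 1 fun y ↦ f y ^ 2 :=
    ((contDiff_id.pow 2).contMDiff.comp hf).of_le (by simp)
  have hfd (y : Y) : MDifferentiableAt (𝓡∂ m) 𝓘(ℝ, ℝ) f y := hf.mdifferentiableAt (by simp)
  -- The square is used because `d(f²) = 2 f df` carries the factor `f` of `φ`; no bound on `df`
  -- alone is available near `f = 0`.
  have hsq {γ : ℝ → Y} (hγ : ContMDiff 𝓘(ℝ, ℝ) (𝓡∂ m) 1 γ) {R : ℝ}
      (hl : g₁.len γ 0 1 < ENNReal.ofReal R) {t : ℝ} (ht : t ∈ Icc (0 : ℝ) 1) :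
      |f (γ t) ^ 2 - f (γ 0) ^ 2| < R := by
    have h1 := g₁.abs_sub_le_len (c := 1) ht.1 hγ (fun s _ ↦ hf2 (γ s)) (fun s _ v ↦ by
      rw [dirDeriv_sq (hfd _), abs_mul, abs_of_nonneg (mul_nonneg zero_le_two (hf01 _).1), one_mul]
      refine le_trans ?_ (hnrm _ v)
      rw [mul_assoc _ (ψ _)]
      exact mul_le_mul_of_nonneg_left (hψf _ v) (mul_nonneg zero_le_two (hf01 _).1)) zero_le_one
    rw [ENNReal.ofReal_one, one_mul] at h1
    exact (ENNReal.ofReal_lt_ofReal_iff_of_nonneg (abs_nonneg _)).1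
      ((h1.trans (g₁.len_mono γ le_rfl ht.2)).trans_lt hl)
  rw [isCompleteMetric_iff]
  intro u (hu : g₁.IsCauchy u)
  have hsqu (k n : ℕ) (R : ℝ) (hR : g₁.edist (u k) (u n) < ENNReal.ofReal R) :
      |f (u n) ^ 2 - f (u k) ^ 2| < R := by
    obtain ⟨γ, h0, h1, hγ, hl⟩ := g₁.exists_len_lt hR
    have := hsq hγ hl ⟨zero_le_one, le_rfl⟩
    rwa [h0, h1] at this
  have hcau : CauchySeq fun n ↦ f (u n) ^ 2 := by
    rw [Metric.cauchySeq_iff]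
    intro ε hε
    obtain ⟨n₀, hn₀⟩ := hu ε hε
    exact ⟨n₀, fun k hk n hn ↦ hsqu n k ε (hn₀ n hn k hk)⟩
  obtain ⟨c, hc⟩ := cauchySeq_tendsto_of_complete hcau
  have hc0 : 0 ≤ c := ge_of_tendsto' hc fun n ↦ sq_nonneg _
  rcases hc0.lt_or_eq with hcpos | rfl
  -- Along paths of length less than `c / 4` from `u n₀`, `f² ≥ 3c/4 - c/4 = c/2`, hence `f ≥ c/2`
  -- because `0 ≤ f ≤ 1`. There `dρ` is bounded by `1 / c`, so `ρ` varies by at most 1.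
  · obtain ⟨n₁, hn₁⟩ := hu (c / 4) (by positivity)
    obtain ⟨n₂, hn₂⟩ := eventually_atTop.1 (hc.eventually (lt_mem_nhds (show 3 / 4 * c < c by linarith)))
    set n₀ := max n₁ n₂
    refine hu.exists_tendsto_of_frequently_mem (hcpt (ρ (u n₀) + 1)) (Eventually.frequently ?_)
    filter_upwards [eventually_ge_atTop n₀] with n hn
    obtain ⟨γ, h0, h1, hγ, hl⟩ := g₁.exists_len_lt
      (hn₁ n₀ (le_max_left _ _) n ((le_max_left _ _).trans hn))
    have hfγ (t : ℝ) (ht : t ∈ Icc (0 : ℝ) 1) : c / 2 ≤ f (γ t) := by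
      have h2 := abs_lt.1 (hsq hγ hl ht)
      rw [h0] at h2
      have h3 := hn₂ n₀ (le_max_right _ _)
      have h4 : f (γ t) ^ 2 ≤ f (γ t) := by
        have := hf01 (γ t)
        nlinarith [this.1, this.2]
      linarith
    have h5 := g₁.abs_sub_le_len (c := 1 / c) zero_le_one hγ
      (fun s _ ↦ (hρ.of_le (by simp)) (γ s)) (fun s hs v ↦ by
        rw [one_div, ← div_eq_inv_mul, le_div_iff₀ hcpos, mul_comm]
        refine le_trans ?_ (hnrm _ v)
        rw [mul_assoc _ (ψ _)]
        exact mul_le_mul (by linarith [hfγ s hs]) (hψρ _ v) (abs_nonneg _)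
          (mul_nonneg zero_le_two (hf01 _).1)) (by positivity)
    have h6 : ENNReal.ofReal (1 / c) * g₁.len γ 0 1 ≤ ENNReal.ofReal 1 := by
      calc _ ≤ ENNReal.ofReal (1 / c) * ENNReal.ofReal (c / 4) := by gcongr
        _ ≤ ENNReal.ofReal 1 := by
          rw [← ENNReal.ofReal_mul (by positivity)]
          refine ENNReal.ofReal_le_ofReal ?_
          rw [one_div, ← div_eq_inv_mul, div_div, mul_comm, ← div_div, div_self hcpos.ne']
          norm_num
    have h7 := (ENNReal.ofReal_le_ofReal_iff zero_le_one).1 (h5.trans h6)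
    rw [h0, h1] at h7
    have := (abs_le.1 h7).2
    change ρ (u n) ≤ ρ (u n₀) + 1
    linarith
  -- On a tail `f² < 1/2`, and paths of length less than 1/4 keep `f² < 3/4`; thus `f ≠ 1` and they
  -- remain close to the image of `j`.
  · obtain ⟨n₁, hn₁⟩ := hu (1 / 4) (by positivity)
    obtain ⟨n₂, hn₂⟩ := eventually_atTop.1 (hc.eventually (gt_mem_nhds (show (0 : ℝ) < 1 / 2 by norm_num)))
    set n₀ := max n₁ n₂
    have hsmall (n : ℕ) : f (u (n + n₀)) ^ 2 < 1 / 2 :=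
      hn₂ _ ((le_max_right _ _).trans (Nat.le_add_left _ _))
    have hV (y : Y) (hy : f y ^ 2 < 1) : ∃ a, g'.edist y (j a) < ENNReal.ofReal (lam a / 8) :=
      hf1 y fun h1 ↦ by norm_num [h1] at hy
    obtain ⟨x, hx⟩ := h.exists_tendsto (g₁ := g₁) hg hj
      (g'.len_le_len_conformal hφ hφ0) (u := fun n ↦ u (n + n₀))
      (fun c hc ↦ by
        obtain ⟨n₃, hn₃⟩ := hu c hc
        exact ⟨n₃, fun k hk n hn ↦ hn₃ _ (Nat.le_add_right_of_le hk) _ (Nat.le_add_right_of_le hn)⟩)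
      (fun k n R hR ↦ by
        have hR' := hn₁ (k + n₀) ((le_max_left _ _).trans (Nat.le_add_left _ _)) (n + n₀)
          ((le_max_left _ _).trans (Nat.le_add_left _ _))
        obtain ⟨γ, h0, h1, hγ, hl⟩ := g₁.exists_len_lt (lt_min hR hR')
        refine ⟨γ, h0, h1, hγ, hl.trans_le (min_le_left _ _), fun t ht ↦ hV _ ?_⟩
        have h2 := abs_lt.1 (hsq hγ (hl.trans_le (min_le_right _ _)) ht)
        rw [h0] at h2
        linarith [hsmall k])
      (fun n ↦ hV _ (by linarith [hsmall n]))
    exact ⟨x, (tendsto_add_atTop_iff_nat n₀).1 hx⟩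

theorem IsRiemannianExtension.nrm_mfderiv {g : SmoothMetric m X} {g' : SmoothMetric m Y}
    {j : X → Y} (hj : IsRiemannianExtension g g' j) (p : X) (v : TangentSpace (𝓡∂ m) p) :
    g'.nrm (j p) (mfderiv (𝓡∂ m) (𝓡∂ m) j p v) = g.nrm p v :=
  congrArg Real.sqrt (hj.isometric p v v)

/-- A Riemannian extension of a complete manifold, with closed image, becomes complete after a
conformal deformation with a factor that is trivial on the image. -/
theorem IsRiemannianExtension.exists_isCompleteMetric_conformal [T2Space X] [T2Space Y]
    [SigmaCompactSpace Y] {g : SmoothMetric m X} {g' : SmoothMetric m Y} {j : X → Y}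
    (hj : IsRiemannianExtension g g' j) (hg : IsCompleteMetric g) (hclosed : IsClosed (range j)) :
    ∃ (φ : Y → ℝ) (hφ : ContMDiff (𝓡∂ m) 𝓘(ℝ, ℝ) ∞ φ),
      (∀ x, φ (j x) = 0) ∧ IsCompleteMetric (g'.conformal φ hφ) := by
  have : LocallyCompactSpace Y := Manifold.locallyCompact_of_finiteDimensional (𝓡∂ m)
  obtain ⟨lam, h⟩ := exists_isRadius g g' (hj.contMDiff.of_le (by simp)) hj.isEmbedding
    hj.nrm_mfderiv
  let V : Set Y := ⋃ a, {y | g'.edist y (j a) < ENNReal.ofReal (lam a / 8)}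
  have hV : IsOpen V := isOpen_iUnion fun a ↦ g'.isOpen_edist_lt _ _
  have hdisj : Disjoint (range j) Vᶜ := by
    rw [disjoint_compl_right_iff_subset]
    rintro _ ⟨a, rfl⟩
    refine mem_iUnion.2 ⟨a, ?_⟩
    change g'.edist (j a) (j a) < _
    rw [g'.edist_self]
    exact ENNReal.ofReal_pos.2 (by linarith [h.pos a])
  obtain ⟨f, hf, hf01, hf0, hf1⟩ := exists_contMDiff_zero_iff_one_iff_of_isClosed (n := (⊤ : ℕ∞))
    (𝓡∂ m) hclosed hV.isClosed_compl hdisj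
  obtain ⟨ρ, hρ, hcpt⟩ := exists_contMDiff_isCompact_le (m := m) (X := Y)
  obtain ⟨ψ, hψ, hψb⟩ := g'.exists_contMDiff_abs_dirDeriv_le (hf.of_le (by simp))
    (hρ.of_le (by simp))
  have hφ : ContMDiff (𝓡∂ m) 𝓘(ℝ, ℝ) ∞ fun y ↦ 2 * f y * ψ y :=
    (contMDiff_const.mul hf).mul hψ
  refine ⟨_, hφ, fun x ↦ ?_, h.isCompleteMetric_conformal hg hj.contMDiff.continuous hf hρ
    (fun y ↦ hf01 (mem_range_self y)) (fun y hy ↦ ?_) hcpt (fun y ↦ (hψb y).1)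
    (fun y v ↦ ((hψb y).2 v).1) (fun y v ↦ ((hψb y).2 v).2) hφ⟩
  · simp [(hf0 (j x)).1 (mem_range_self x)]
  · by_contra hn
    exact hy ((hf1 y).1 fun hyV ↦ hn (mem_iUnion.1 hyV))

end RiemExt

end

/-! ### The main theorem -/

theorem mainTheorem3 (m : ℕ) [NeZero m]
    {M : Type*} [TopologicalSpace M] [T2Space M] [SecondCountableTopology M]
    [ChartedSpace (EuclideanHalfSpace m) M] [IsManifold (𝓡∂ m) ∞ M]
    {P : Type*} [TopologicalSpace P] [T2Space P] [SecondCountableTopology P]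
    [ChartedSpace (EuclideanHalfSpace m) P] [IsManifold (𝓡∂ m) ∞ P]
    {N : Type*} [TopologicalSpace N] [T2Space N] [SecondCountableTopology N]
    [ChartedSpace (EuclideanHalfSpace m) N] [IsManifold (𝓡∂ m) ∞ N]
    (gM : RiemExt.SmoothMetric m M) (gP : RiemExt.SmoothMetric m P)
    (gTilde : RiemExt.SmoothMetric m N)
    (hM : ((𝓡∂ m).boundary M).Nonempty) (hP : ((𝓡∂ m).boundary P).Nonempty)
    (i : M → P) (hi : RiemExt.IsRiemannianExtension gM gP i)
    (hcomplete : RiemExt.IsCompleteMetric gP)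
    (j : P → N) (hj : RiemExt.IsRiemannianExtension gP gTilde j)
    (hclosed : IsClosed (range j)) :
    ∃ gN : RiemExt.SmoothMetric m N,
      RiemExt.IsRiemannianExtension gM gN (j ∘ i) ∧
      RiemExt.IsCompleteMetric gN ∧
      ∃ φ : N → ℝ, ContMDiff (𝓡∂ m) 𝓘(ℝ, ℝ) ∞ φ ∧
        Disjoint (tsupport φ) (range (j ∘ i)) ∧
        ∀ (x : N) (v w : TangentSpace (𝓡∂ m) x),
          gN.inner x v w = Real.exp (2 * φ x) * gTilde.inner x v w := by
  have : LocallyCompactSpace N := Manifold.locallyCompact_of_finiteDimensional (𝓡∂ m)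
  obtain ⟨φ, hφ, h0, hcomp⟩ := hj.exists_isCompleteMetric_conformal hcomplete hclosed
  refine ⟨gTilde.conformal φ hφ, ⟨hj.contMDiff.comp hi.contMDiff,
    hj.isEmbedding.comp hi.isEmbedding, ?_, fun x v w ↦ ?_⟩, hcomp, φ, hφ, ?_,
    gTilde.conformal_inner hφ⟩
  · exact (range_comp_subset_range i j).trans hj.range_subset_interior
  · have hd : mfderiv (𝓡∂ m) (𝓡∂ m) (j ∘ i) x =
        (mfderiv (𝓡∂ m) (𝓡∂ m) j (i x)).comp (mfderiv (𝓡∂ m) (𝓡∂ m) i x) :=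
      mfderiv_comp x (hj.contMDiff.mdifferentiableAt (by simp))
        (hi.contMDiff.mdifferentiableAt (by simp))
    rw [gTilde.conformal_inner, hd, Function.comp_apply, h0, mul_zero, Real.exp_zero, one_mul]
    exact (hj.isometric (i x) _ _).trans (hi.isometric x v w)
  · rw [disjoint_right]
    rintro _ ⟨x, rfl⟩
    rw [notMem_tsupport_iff_eventuallyEq]
    -- Vanishing on `j(P)` excludes `j (i x)` from the support only because `j(P)` is a
    -- neighbourhood of that point, which uses that `i x` is interior.
    have hint : (𝓡∂ m).IsInteriorPoint (i x) := hi.range_subset_interior (mem_range_self x)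
    have hmem := RiemExt.image_mem_nhds_of_isInteriorPoint
      ((hj.contMDiff (i x)).of_le (by simp)) hint fun v hv ↦ by
        by_contra hv0
        have h1 := gP.pos (i x) v hv0
        rw [← hj.isometric, hv] at h1
        simp at h1
    filter_upwards [hmem] with _ ⟨p, hp⟩
    rw [← hp]
    exact h0 p
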